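/- Let $G$ be a finite simple graph embedded in the plane: its vertices are distinct points, its edges are simple arcs joining their endpoints, and the relative interior of an edge meets no vertex and no interior of another edge. The faces of $G$ are the connected components of the complement of the drawing; exactly one of them, the exterior face, is unbounded, and the others are called finite. An edge is an edge of a face $F$ if it is contained in the boundary of $F$. The signature of a cycle $C$ in $G$ is the function that assigns to each finite face $F$ the number of edges of $F$ that belong to $C$. If two cycles $C_1$ and $C_2$ in $G$ have the same signature, then $C_1$ and $C_2$ have the same length, and the number of edges of the exterior face that belong to $C_1$ equals the number of edges of the exterior face that belong to $C_2$. -/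

import Mathlib

/-- A plane graph: an embedding of the simple graph `G` in the Euclidean plane, which we identify
with `ℂ`. Vertices are distinct points, each edge is a simple arc joining its two endpoints, and
the relative interior of an edge meets neither a vertex nor the interior of another edge. -/
structure PlaneEmbedding {V : Type*} (G : SimpleGraph V) where
  /-- The position of a vertex. -/
  point : V → ℂ
  point_injective : Function.Injective point
  /-- A parametrization of the arc that represents an edge (in one of its two directions). -/
  arc : G.edgeSet → C(unitInterval, ℂ)
  arc_injective : ∀ e, Function.Injective (arc e)
  arc_ends : ∀ e, s(arc e 0, arc e 1) = Sym2.map point (e : Sym2 V)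
  arc_interior_ne_point : ∀ e, ∀ t ∈ Set.Ioo (0 : unitInterval) 1, ∀ v, arc e t ≠ point v
  arc_interior_disjoint : ∀ e f, e ≠ f →
    Disjoint (arc e '' Set.Ioo (0 : unitInterval) 1) (arc f '' Set.Ioo (0 : unitInterval) 1)

namespace PlaneEmbedding

/-- The set of all points of the plane that lie on the drawing of the graph. -/
def support {V : Type*} {G : SimpleGraph V} (D : PlaneEmbedding G) : Set ℂ :=
  Set.range D.point ∪ ⋃ e, Set.range (D.arc e)

/-- The faces are the connected components of the complement of the drawing. -/
def IsFace {V : Type*} {G : SimpleGraph V} (D : PlaneEmbedding G) (F : Set ℂ) : Prop :=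
  ∃ z ∈ D.supportᶜ, F = connectedComponentIn D.supportᶜ z

/-- The finite faces are the bounded ones. -/
def FiniteFace {V : Type*} {G : SimpleGraph V} (D : PlaneEmbedding G) : Type :=
  {F : Set ℂ // D.IsFace F ∧ Bornology.IsBounded F}

theorem isCompact_support {V : Type*} [Finite V] {G : SimpleGraph V} (D : PlaneEmbedding G) :
    IsCompact D.support :=
  (Set.finite_range D.point).isCompact.union
    (isCompact_iUnion fun e => isCompact_range (D.arc e).continuous)

/-- A finite plane graph has exactly one unbounded face. -/
theorem existsUnique_exteriorFace {V : Type*} [Finite V] {G : SimpleGraph V}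
    (D : PlaneEmbedding G) : ∃! F : Set ℂ, D.IsFace F ∧ ¬ Bornology.IsBounded F := by
  obtain ⟨R₀, hR₀⟩ := D.isCompact_support.isBounded.subset_closedBall (0 : ℂ)
  obtain ⟨R, hRpos, hR⟩ : ∃ R : ℝ, 0 < R ∧ D.support ⊆ Metric.closedBall (0 : ℂ) R :=
    ⟨max R₀ 1, by positivity, hR₀.trans (Metric.closedBall_subset_closedBall (le_max_left _ _))⟩
  have hO : IsPreconnected (Metric.closedBall (0 : ℂ) R)ᶜ := by
    have heq : (Metric.closedBall (0 : ℂ) R)ᶜ = Complex.exp '' {z : ℂ | Real.log R < z.re} := by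
      ext z
      simp only [Set.mem_compl_iff, mem_closedBall_zero_iff, not_le, Set.mem_image,
        Set.mem_ofPred_eq]
      constructor
      · intro h
        have hz : z ≠ 0 := norm_pos_iff.1 (hRpos.trans h)
        exact ⟨Complex.log z, by rw [Complex.log_re]; exact Real.log_lt_log hRpos h,
          Complex.exp_log hz⟩
      · rintro ⟨y, hy, rfl⟩
        rw [Complex.norm_exp]
        exact (Real.log_lt_iff_lt_exp hRpos).1 hy
    rw [heq]
    exact (convex_halfSpace_re_gt _).isPreconnected.image _ Complex.continuous_exp.continuousOn
  have hOU : (Metric.closedBall (0 : ℂ) R)ᶜ ⊆ D.supportᶜ := Set.compl_subset_compl.2 hR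
  have hmeet : ∀ F : Set ℂ, ¬ Bornology.IsBounded F →
      ∃ z ∈ F, z ∈ (Metric.closedBall (0 : ℂ) R)ᶜ := by
    intro F hF
    by_contra! h
    exact hF ((Metric.isBounded_closedBall (x := (0 : ℂ)) (r := R)).subset fun z hz => by
      simpa using h z hz)
  have hun : ¬ Bornology.IsBounded (Set.univ : Set ℂ) := NormedSpace.unbounded_univ ℝ ℂ
  obtain ⟨w, -, hw⟩ := hmeet _ hun
  refine ⟨connectedComponentIn D.supportᶜ w, ⟨⟨w, hOU hw, rfl⟩, fun hb => hun ?_⟩, ?_⟩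
  · have := hb.subset (hO.subset_connectedComponentIn hw hOU)
    have := this.union (Metric.isBounded_closedBall (x := (0 : ℂ)) (r := R))
    rwa [Set.compl_union_self] at this
  · rintro F ⟨⟨z, hz, rfl⟩, hF⟩
    obtain ⟨y, hyF, hy⟩ := hmeet _ hF
    rw [connectedComponentIn_eq hyF]
    exact (connectedComponentIn_eq (hO.subset_connectedComponentIn hw hOU hy)).symm

/-- The exterior face is the unbounded one. -/
noncomputable def exteriorFace {V : Type*} [Finite V] {G : SimpleGraph V}
    (D : PlaneEmbedding G) : Set ℂ :=
  D.existsUnique_exteriorFace.choose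

/-- The edges of a face are the edges that are contained in its boundary. -/
def IsEdgeOfFace {V : Type*} {G : SimpleGraph V} (D : PlaneEmbedding G) (e : G.edgeSet)
    (F : Set ℂ) : Prop :=
  Set.range (D.arc e) ⊆ frontier F

/-- The number of edges of the face `F` that belong to the closed walk `c`. -/
noncomputable def clue {V : Type*} {G : SimpleGraph V} (D : PlaneEmbedding G) {u : V}
    (c : G.Walk u u) (F : Set ℂ) : ℕ :=
  Set.ncard {e : G.edgeSet | (e : Sym2 V) ∈ c.edges ∧ D.IsEdgeOfFace e F}

/-- The signature: the assignment of clues to all finite faces. -/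
noncomputable def signature {V : Type*} {G : SimpleGraph V} (D : PlaneEmbedding G) {u : V}
    (c : G.Walk u u) : D.FiniteFace → ℕ :=
  fun F => D.clue c F.1

end PlaneEmbedding

/-! Let `w₁`, `w₂` be the winding numbers of the two cycles, and call a face odd if `w₁ + w₂` is odd
on it. Both vanish on the exterior face, so odd faces are finite and the cycles have equal clues
there. Add up these clues. Common edges contribute equally to both sums; an edge of just one cycle
has exactly one odd side, since crossing it changes one winding number by `±1` and keeps the other.
Hence `C₁ \ C₂` and `C₂ \ C₁` have equally many edges, and the lengths agree. Over all faces every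
cycle edge is counted twice, so the totals agree and the exterior clue is what remains.

The topological input is `exists_two_faces`, proved with continuous logarithms. By Eilenberg's
criterion, `connectedComponentIn_eq_of_isLogOn`, a compact set `K` does not separate `x` from `y` if
`(z - x) / (z - y)` has a logarithm on `K`. Let `γ` be the arc of the edge and `L` the rest of the
drawing. For `x`, `y` in one component of `Lᶜ` there are logarithms on `L` and on `γ`, and `w x - w
y` is the obstruction to gluing them. For three components, powers of the quotients make the
obstructions cancel, which contradicts `eq_zero_of_isLogOn_zpow`; so there are at most two sides
(`not_three_components`).

That there are two, with `w` differing by `±1`, follows from `dvd_one`. Along the perpendicular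
bisector of the ends of `γ`, the change of the logarithm along `γ`, corrected by the view angle of
the chord, gains `2πi` in total. It can jump only at `γ`, and only by multiples of `2πi n` if `n`
divides the differences of `w`. -/

section

open Complex Set Topology

/-! ### Continuous logarithms -/

/-- A continuous logarithm of a constant is constant on preconnected sets. -/
theorem IsPreconnected.eq_of_exp_eq {X : Type*} [TopologicalSpace X] {S : Set X}
    (hS : IsPreconnected S) {g : X → ℂ} (hg : ContinuousOn g S)
    (hexp : ∀ z ∈ S, ∀ w ∈ S, exp (g z) = exp (g w)) {z w : X} (hz : z ∈ S) (hw : w ∈ S) :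
    g z = g w := by
  refine hS.induction₂ (fun a b => g a = g b) (fun a ha => ?_) (fun a b c _ _ _ => Eq.trans)
    (fun a b _ _ => Eq.symm) hz hw
  have h1 : ∀ᶠ b in 𝓝[S] a, dist (g b) (g a) < 1 :=
    (hg a ha).eventually (Metric.ball_mem_nhds _ one_pos)
  filter_upwards [h1, self_mem_nhdsWithin] with b hb hbS
  obtain ⟨n, hn⟩ := Complex.exp_eq_exp_iff_exists_int.1 (hexp b hbS a ha)
  have hd : ‖(n : ℂ) * (2 * Real.pi * I)‖ < 1 := by
    rw [dist_eq_norm, hn] at hb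
    simpa using hb
  have hn0 : n = 0 := by
    by_contra hne
    have h1n : (1 : ℝ) ≤ |(n : ℝ)| := by exact_mod_cast Int.one_le_abs hne
    have : ‖(n : ℂ) * (2 * Real.pi * I)‖ = |(n : ℝ)| * (2 * Real.pi) := by
      simp [abs_of_pos Real.pi_pos]
    rw [this] at hd
    nlinarith [Real.pi_gt_three]
  rw [hn, hn0]
  simp

/-- `h` is a continuous logarithm of `f` on `S`. -/
def IsLogOn {X : Type*} [TopologicalSpace X] (S : Set X) (f h : X → ℂ) : Prop :=
  ContinuousOn h S ∧ ∀ z ∈ S, exp (h z) = f z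

namespace IsLogOn

variable {X : Type*} [TopologicalSpace X] {S T : Set X} {f f' h h' : X → ℂ}

theorem mono (hh : IsLogOn S f h) (hT : T ⊆ S) : IsLogOn T f h :=
  ⟨hh.1.mono hT, fun z hz => hh.2 z (hT hz)⟩

theorem congr (hh : IsLogOn S f h) (hf : ∀ z ∈ S, f z = f' z) : IsLogOn S f' h :=
  ⟨hh.1, fun z hz => (hh.2 z hz).trans (hf z hz)⟩

theorem add (hh : IsLogOn S f h) (hh' : IsLogOn S f' h') :
    IsLogOn S (fun z => f z * f' z) (fun z => h z + h' z) :=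
  ⟨hh.1.add hh'.1, fun z hz => by rw [exp_add, hh.2 z hz, hh'.2 z hz]⟩

theorem sub (hh : IsLogOn S f h) (hh' : IsLogOn S f' h') :
    IsLogOn S (fun z => f z / f' z) (fun z => h z - h' z) :=
  ⟨hh.1.sub hh'.1, fun z hz => by rw [exp_sub, hh.2 z hz, hh'.2 z hz]⟩

theorem neg (hh : IsLogOn S f h) : IsLogOn S (fun z => (f z)⁻¹) (fun z => -h z) :=
  ⟨hh.1.neg, fun z hz => by rw [exp_neg, hh.2 z hz]⟩

theorem zsmul (hh : IsLogOn S f h) (n : ℤ) :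
    IsLogOn S (fun z => f z ^ n) (fun z => n * h z) :=
  ⟨hh.1.const_mul _, fun z hz => by rw [exp_int_mul, hh.2 z hz]⟩

theorem log (hf : ContinuousOn f S) (hs : ∀ z ∈ S, f z ∈ slitPlane) :
    IsLogOn S f (fun z => Complex.log (f z)) :=
  ⟨hf.clog hs, fun z hz => exp_log (slitPlane_ne_zero (hs z hz))⟩

end IsLogOn

/-- Points that a connected set disjoint from `S` joins have a quotient with a logarithm on `S`. -/
theorem exists_isLogOn_ratio {S U : Set ℂ} (hS : IsClosed S) (hU : IsPreconnected U)
    (hUS : U ⊆ Sᶜ) {x y : ℂ} (hx : x ∈ U) (hy : y ∈ U) :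
    ∃ h, IsLogOn S (fun z => (z - x) / (z - y)) h := by
  refine hU.induction₂ (fun a b => ∃ h, IsLogOn S (fun z => (z - a) / (z - b)) h)
    (fun a ha => ?_) (fun a b c _ hb _ => ?_) (fun a b _ _ => ?_) hx hy
  · obtain ⟨r, hr, hball⟩ := Metric.isOpen_iff.1 hS.isOpen_compl a (hUS ha)
    -- Within `r / 2` of `a`, the point `b` is closer to `a` than to `S`, so the quotient stays in
    -- the unit disc around `1`.
    filter_upwards [mem_nhdsWithin_of_mem_nhds (Metric.ball_mem_nhds a (half_pos hr))] with b hb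
    have hd : ∀ z ∈ S, dist b a < dist z b := by
      intro z hz
      have hza : r ≤ dist z a := by
        by_contra! hlt
        exact hball hlt hz
      have := dist_triangle z b a
      rw [Metric.mem_ball] at hb
      linarith
    have hne : ∀ z ∈ S, z - b ≠ 0 := by
      intro z hz h0
      have := hd z hz
      rw [dist_eq_norm z b, h0, norm_zero] at this
      exact absurd this (not_lt.2 dist_nonneg)
    refine ⟨_, IsLogOn.log (ContinuousOn.div (by fun_prop) (by fun_prop) hne) fun z hz => ?_⟩
    have h2 : (z - a) / (z - b) = 1 + (b - a) / (z - b) := by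
      field_simp [hne z hz]
      ring
    rw [h2]
    apply mem_slitPlane_of_norm_lt_one
    rw [norm_div, div_lt_one (norm_pos_iff.2 (hne z hz)), ← dist_eq_norm, ← dist_eq_norm]
    exact hd z hz
  · rintro ⟨h, hh⟩ ⟨h', hh'⟩
    refine ⟨_, (hh.add hh').congr fun z hz => ?_⟩
    have : z - b ≠ 0 := fun h0 => hUS hb (by rwa [← sub_eq_zero.1 h0])
    field_simp
  · rintro ⟨h, hh⟩
    exact ⟨_, hh.neg.congr fun z hz => by rw [inv_div]⟩

theorem isPreconnected_compl_closedBall_zero {R : ℝ} (hRpos : 0 < R) :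
    IsPreconnected (Metric.closedBall (0 : ℂ) R)ᶜ := by
  have heq : (Metric.closedBall (0 : ℂ) R)ᶜ = Complex.exp '' {z : ℂ | Real.log R < z.re} := by
    ext z
    simp only [Set.mem_compl_iff, mem_closedBall_zero_iff, not_le, Set.mem_image,
      Set.mem_ofPred_eq]
    constructor
    · intro h
      have hz : z ≠ 0 := norm_pos_iff.1 (hRpos.trans h)
      exact ⟨Complex.log z, by rw [Complex.log_re]; exact Real.log_lt_log hRpos h,
        Complex.exp_log hz⟩
    · rintro ⟨y, hy, rfl⟩
      rw [Complex.norm_exp]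
      exact (Real.log_lt_iff_lt_exp hRpos).1 hy
  rw [heq]
  exact (convex_halfSpace_re_gt _).isPreconnected.image _ Complex.continuous_exp.continuousOn

/-! ### Separation of points by compact plane sets -/

/-- The complement of a compact plane set has at most one unbounded component. -/
theorem connectedComponentIn_eq_of_not_isBounded {K : Set ℂ} (hK : IsCompact K) {x y : ℂ}
    (hx : ¬ Bornology.IsBounded (connectedComponentIn Kᶜ x))
    (hy : ¬ Bornology.IsBounded (connectedComponentIn Kᶜ y)) :
    connectedComponentIn Kᶜ x = connectedComponentIn Kᶜ y := by
  obtain ⟨R₀, hR₀⟩ := hK.isBounded.subset_closedBall (0 : ℂ)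
  obtain ⟨R, hRpos, hR⟩ : ∃ R : ℝ, 0 < R ∧ K ⊆ Metric.closedBall (0 : ℂ) R :=
    ⟨max R₀ 1, by positivity, hR₀.trans (Metric.closedBall_subset_closedBall (le_max_left _ _))⟩
  have hmeet : ∀ F : Set ℂ, ¬ Bornology.IsBounded F →
      ∃ z ∈ F, z ∈ (Metric.closedBall (0 : ℂ) R)ᶜ := by
    intro F hF
    by_contra! h
    exact hF ((Metric.isBounded_closedBall (x := (0 : ℂ)) (r := R)).subset fun z hz => by
      simpa using h z hz)
  obtain ⟨a, ha, ha'⟩ := hmeet _ hx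
  obtain ⟨b, hb, hb'⟩ := hmeet _ hy
  rw [connectedComponentIn_eq ha, connectedComponentIn_eq hb]
  exact connectedComponentIn_eq ((isPreconnected_compl_closedBall_zero hRpos
    |>.subset_connectedComponentIn ha' (Set.compl_subset_compl.2 hR)) hb')

/-- Components of an open set are open, so a frontier point in `U` would have a component that
meets, hence equals, the given one. -/
theorem frontier_connectedComponentIn_subset {U : Set ℂ} (hU : IsOpen U) (x : ℂ) :
    frontier (connectedComponentIn U x) ⊆ Uᶜ := by
  intro z hz hzU
  have hopen : IsOpen (connectedComponentIn U z) := hU.connectedComponentIn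
  obtain ⟨w, hw, hw'⟩ := mem_closure_iff.1 (frontier_subset_closure hz) _ hopen
    (mem_connectedComponentIn hzU)
  have heq : connectedComponentIn U x = connectedComponentIn U z :=
    (connectedComponentIn_eq hw').trans (connectedComponentIn_eq hw).symm
  rw [(hU.connectedComponentIn).frontier_eq] at hz
  exact hz.2 (heq ▸ mem_connectedComponentIn hzU)

/-- A nonvanishing continuous function on a real vector space has a continuous logarithm. -/
theorem exists_continuous_exp_eq {E : Type*} [NormedAddCommGroup E] [NormedSpace ℝ E] {f : E → ℂ}
    (hf : Continuous f) (hf0 : ∀ z, f z ≠ 0) : ∃ g : E → ℂ, Continuous g ∧ ∀ z, exp (g z) = f z := by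
  have hsc : IsSimplyConnected (univ : Set E) := by
    have : ContractibleSpace (univ : Set E) := convex_univ.contractibleSpace ⟨0, mem_univ 0⟩
    exact SimplyConnectedSpace.ofContractible _
  obtain ⟨g, hgc, hg⟩ := exists_continuousOn_eqOn_exp_comp hsc isOpen_univ hf.continuousOn
    (by rintro ⟨z, -, hz⟩; exact hf0 z hz)
  exact ⟨g, continuousOn_univ.1 hgc, fun z => hg (mem_univ z)⟩

/-- A power of `z - x` that agrees on the boundary of a bounded open set around `x` with
a nonvanishing function times an exponential is trivial. -/
theorem eq_zero_of_isLogOn_frontier {U K : Set ℂ} (hUo : IsOpen U) (hUb : Bornology.IsBounded U)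
    (hK : IsClosed K) (hUK : frontier U ⊆ K) {x : ℂ} (hx : x ∈ U) {k : ℤ} {R h : ℂ → ℂ}
    (hR : ContinuousOn R (closure U)) (hR0 : ∀ z ∈ closure U, R z ≠ 0)
    (hh : IsLogOn K (fun z => (z - x) ^ k * R z) h) : k = 0 := by
  classical
  -- Tietze extension of the logarithm from `K` to the plane.
  obtain ⟨H, hH⟩ := ContinuousMap.exists_restrict_eq hK
    (⟨K.domRestrict h, continuousOn_iff_continuous_domRestrict.1 hh.1⟩ : C(K, ℂ))
  have hHK : ∀ z ∈ K, H z = h z := fun z hz => congrArg (fun F => F ⟨z, hz⟩) hH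
  have hxne : ∀ z ∉ U, z - x ≠ 0 := fun z hz h0 => hz (by rwa [sub_eq_zero.1 h0])
  -- The two formulas agree on `frontier U` by `hh`, and the power is used only away from its zero
  -- or pole `x`.
  set F : ℂ → ℂ := (closure U).piecewise (fun z => exp (H z) / R z) (fun z => (z - x) ^ k)
  have hFc : Continuous F := by
    apply continuous_piecewise
    · intro z hz
      have hzU : z ∈ frontier U := frontier_closure_subset hz
      have h2 := hh.2 z (hUK hzU)
      simp only [hHK z (hUK hzU), h2]
      field_simp [hR0 z (frontier_subset_closure hzU)]
    · rw [closure_closure]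
      exact (continuous_exp.comp H.continuous).continuousOn.div hR hR0
    · have hsub : closure (closure U)ᶜ ⊆ Uᶜ :=
        closure_minimal (compl_subset_compl.2 subset_closure) hUo.isClosed_compl
      refine ContinuousOn.zpow₀ (by fun_prop) _ fun z hz => Or.inl (hxne z (hsub hz))
  have hF0 : ∀ z, F z ≠ 0 := by
    intro z
    by_cases hz : z ∈ closure U
    · simp only [F, Set.piecewise_eq_of_mem _ _ _ hz]
      exact div_ne_zero (exp_ne_zero _) (hR0 z hz)
    · simp only [F, Set.piecewise_eq_of_notMem _ _ _ hz]
      exact zpow_ne_zero _ (hxne z fun h => hz (subset_closure h))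
  obtain ⟨g, hgc', hg⟩ := exists_continuous_exp_eq hFc hF0
  obtain ⟨r₀, hr₀⟩ := hUb.closure.subset_closedBall x
  set r : ℝ := max r₀ 0 + 1
  have hr : 0 < r := by positivity
  have hout : ∀ θ : ℝ, exp (g (x + r * exp (θ * I))) = r ^ k * exp (k * (θ * I)) := by
    intro θ
    have hnm : x + r * exp (θ * I) ∉ closure U := by
      intro hmem
      have h1 := hr₀ hmem
      rw [Metric.mem_closedBall, dist_eq_norm] at h1
      simp [norm_exp_ofReal_mul_I, abs_of_pos hr] at h1
      have := le_max_left r₀ 0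
      simp only [r] at h1
      linarith
    have h2 := hg (x + r * exp (θ * I))
    simp only [F, Set.piecewise_eq_of_notMem _ _ _ hnm] at h2
    rw [h2, add_sub_cancel_left, mul_zpow, exp_int_mul]
  -- Around a circle outside `closure U` the global logarithm `g` would gain `2πi k`, yet it is
  -- single-valued.
  have hconst := isPreconnected_univ.eq_of_exp_eq (X := ℝ) (S := univ)
    (g := fun θ : ℝ => g (x + r * exp (θ * I)) - k * (θ * I)) (by fun_prop)
    (fun θ _ θ' _ => by simp only [exp_sub, hout]; field_simp) (mem_univ 0)
    (mem_univ (2 * Real.pi))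
  have hper : exp (((2 * Real.pi : ℝ) : ℂ) * I) = 1 := by
    push_cast
    exact exp_two_pi_mul_I
  simp only [hper, ofReal_zero, zero_mul, exp_zero, mul_zero, sub_zero] at hconst
  have h3 : (k : ℂ) * (((2 * Real.pi : ℝ) : ℂ) * I) = 0 := by
    linear_combination hconst
  simpa [Real.pi_ne_zero] using h3

/-- The factors at `y` and `w` have no zero or pole on the closure of the component of `x`. Taking
`w = y` and `c = 0` covers two points. -/
theorem eq_zero_of_isLogOn_zpow {K : Set ℂ} (hK : IsCompact K) {x y w : ℂ} (hx : x ∈ Kᶜ)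
    (hy : y ∈ Kᶜ) (hw : w ∈ Kᶜ) (hb : Bornology.IsBounded (connectedComponentIn Kᶜ x))
    (hxy : connectedComponentIn Kᶜ x ≠ connectedComponentIn Kᶜ y)
    (hxw : connectedComponentIn Kᶜ x ≠ connectedComponentIn Kᶜ w) {a b c : ℤ} {h : ℂ → ℂ}
    (hh : IsLogOn K (fun z => (z - x) ^ a * ((z - y) ^ b * (z - w) ^ c)) h) : a = 0 := by
  have hfr : frontier (connectedComponentIn Kᶜ x) ⊆ K := by
    simpa using frontier_connectedComponentIn_subset hK.isClosed.isOpen_compl x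
  have hne : ∀ y ∈ Kᶜ, connectedComponentIn Kᶜ x ≠ connectedComponentIn Kᶜ y →
      ∀ z ∈ closure (connectedComponentIn Kᶜ x), z - y ≠ 0 := by
    intro y hy hxy z hz h0
    rw [sub_eq_zero.1 h0] at hz
    rw [closure_eq_self_union_frontier] at hz
    rcases hz with hz | hz
    · exact hxy (connectedComponentIn_eq hz)
    · exact hy (hfr hz)
  refine eq_zero_of_isLogOn_frontier hK.isClosed.isOpen_compl.connectedComponentIn hb hK.isClosed
    hfr (mem_connectedComponentIn hx) (R := fun z => (z - y) ^ b * (z - w) ^ c) ?_ ?_ hh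
  · exact (ContinuousOn.zpow₀ (by fun_prop) _ fun z hz => Or.inl (hne y hy hxy z hz)).mul
      (ContinuousOn.zpow₀ (by fun_prop) _ fun z hz => Or.inl (hne w hw hxw z hz))
  · exact fun z hz => mul_ne_zero (zpow_ne_zero _ (hne y hy hxy z hz))
      (zpow_ne_zero _ (hne w hw hxw z hz))

/-- Eilenberg's criterion: points whose quotient has a logarithm on a compact set are not
separated by it. -/
theorem connectedComponentIn_eq_of_isLogOn {K : Set ℂ} (hK : IsCompact K) {x y : ℂ} (hx : x ∈ Kᶜ)
    (hy : y ∈ Kᶜ) {h : ℂ → ℂ} (hh : IsLogOn K (fun z => (z - x) / (z - y)) h) :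
    connectedComponentIn Kᶜ x = connectedComponentIn Kᶜ y := by
  by_contra hne
  by_cases hb : Bornology.IsBounded (connectedComponentIn Kᶜ x)
  · have := eq_zero_of_isLogOn_zpow hK hx hy hy hb hne hne (a := 1) (b := -1) (c := 0)
      (hh.congr fun z hz => by simp [div_eq_mul_inv])
    omega
  by_cases hb' : Bornology.IsBounded (connectedComponentIn Kᶜ y)
  · have := eq_zero_of_isLogOn_zpow hK hy hx hx hb' (Ne.symm hne) (Ne.symm hne) (a := -1) (b := 1)
      (c := 0) (hh.congr fun z hz => by simp [div_eq_mul_inv, mul_comm])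
    omega
  · exact hne (connectedComponentIn_eq_of_not_isBounded hK hb hb')

/-! ### Gluing along an arc and the change of the logarithm -/

/-- If an arc is glued to a closed set, functions that agree on the common points can be glued. -/
theorem exists_continuousOn_glue {γ : C(unitInterval, ℂ)} (hγ : Function.Injective γ) {L : Set ℂ}
    (hL : IsClosed L) {T : Set unitInterval} (hT : IsClosed T) {k : ℂ → ℂ} {g : unitInterval → ℂ}
    (hk : ContinuousOn k L) (hg : ContinuousOn g T) (hagree : ∀ t ∈ T, γ t ∈ L → g t = k (γ t)) :
    ∃ h : ℂ → ℂ, ContinuousOn h (L ∪ γ '' T) ∧ (∀ z ∈ L, h z = k z) ∧ ∀ t ∈ T, h (γ t) = g t := by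
  classical
  set h : ℂ → ℂ := fun z => if z ∈ L then k z else g (Function.invFun γ z)
  have h1 : ∀ z ∈ L, h z = k z := fun z hz => by simp [h, hz]
  have h2 : ∀ t ∈ T, h (γ t) = g t := by
    intro t ht
    by_cases hz : γ t ∈ L
    · simp [h, hz, hagree t ht hz]
    · simp [h, hz, Function.leftInverse_invFun hγ t]
  have hemb : IsClosedEmbedding γ := γ.continuous.isClosedEmbedding hγ
  refine ⟨h, ContinuousOn.union_of_isClosed (hk.congr h1) ?_ hL (hemb.isClosedMap _ hT), h1, h2⟩
  rw [hemb.isInducing.continuousOn_image_iff]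
  exact hg.congr h2

theorem exists_continuous_log_sub {γ : C(unitInterval, ℂ)} {x : ℂ} (hx : x ∉ range γ) :
    ∃ g : unitInterval → ℂ, Continuous g ∧ ∀ t, exp (g t) = γ t - x := by
  -- The path is extended to the line by its end values.
  obtain ⟨g, hg, hexp⟩ := exists_continuous_exp_eq (E := ℝ)
    (f := fun s => γ (projIcc 0 1 zero_le_one s) - x)
    ((γ.continuous.comp continuous_projIcc).sub continuous_const)
    (fun s h0 => hx ⟨_, sub_eq_zero.1 h0⟩)
  exact ⟨fun t => g t, by fun_prop, fun t => by rw [hexp]; simp⟩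

open Classical in
/-- The change of the logarithm of `z - x` along the path `γ`. -/
noncomputable def logChange (γ : C(unitInterval, ℂ)) (x : ℂ) : ℂ :=
  if h : ∃ g : unitInterval → ℂ, Continuous g ∧ ∀ t, exp (g t) = γ t - x then
    h.choose 1 - h.choose 0
  -- Reached only if `x` lies on `γ`.
  else 0

/-- Continuous logarithms of proportional functions on the interval differ by a constant, so their
increments agree. -/
theorem logChange_eq {γ : C(unitInterval, ℂ)} {x c : ℂ} (hx : x ∉ range γ)
    {g : unitInterval → ℂ} (hg : Continuous g) (hexp : ∀ t, exp (g t) * c = γ t - x) :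
    logChange γ x = g 1 - g 0 := by
  have h := exists_continuous_log_sub hx
  have h1 := h.choose_spec
  rw [logChange, dif_pos h]
  set k := h.choose
  have hne : ∀ t, γ t - x ≠ 0 := fun t h0 => hx ⟨t, sub_eq_zero.1 h0⟩
  have hc : c ≠ 0 := by
    rintro rfl
    exact hne 0 (by simp [← hexp 0])
  have h3 : ∀ t, exp (k t - g t) = c := by
    intro t
    rw [exp_sub, h1.2, ← hexp]
    field_simp
  have h2 := isPreconnected_univ.eq_of_exp_eq (S := univ) (g := fun t => k t - g t)
    (h1.1.sub hg).continuousOn (fun t _ t' _ => by simp only [h3])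
    (mem_univ 1) (mem_univ 0)
  linear_combination h2

theorem logChange_sub_logChange {γ : C(unitInterval, ℂ)} {x y c : ℂ} (hx : x ∉ range γ)
    (hy : y ∉ range γ) {g : unitInterval → ℂ} (hg : Continuous g)
    (hexp : ∀ t, exp (g t) * c = (γ t - x) / (γ t - y)) :
    logChange γ x - logChange γ y = g 1 - g 0 := by
  obtain ⟨k, hk, hkexp⟩ := exists_continuous_log_sub hy
  rw [logChange_eq hx (hk.add hg) (c := c), logChange_eq hy hk (c := 1)]
  · simp only [Pi.add_apply]
    ring
  · simpa using hkexp
  · intro t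
    have hne : γ t - y ≠ 0 := fun h0 => hy ⟨t, sub_eq_zero.1 h0⟩
    simp only [Pi.add_apply, exp_add, hkexp, mul_assoc, hexp]
    field_simp

theorem logChange_sub_of_isLogOn {γ : C(unitInterval, ℂ)} {x y : ℂ} (hx : x ∉ range γ)
    (hy : y ∉ range γ) {h : ℂ → ℂ} (hh : IsLogOn (range γ) (fun z => (z - x) / (z - y)) h) :
    logChange γ x - logChange γ y = h (γ 1) - h (γ 0) :=
  logChange_sub_logChange (g := fun t => h (γ t)) (c := 1) hx hy
    (hh.1.comp_continuous γ.continuous fun t => mem_range_self t)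
    fun t => by rw [mul_one, hh.2 _ (mem_range_self t)]

/-! ### The sides of an arc of a loop: at most two -/

/-- `γ` is an arc attached to the compact set `L`, `β x` is the change of the logarithm of `z - x`
along some path in `L` that joins the ends of `γ`, and `w x` is the winding number around `x` of
the closed curve that consists of `γ` and that path. -/
structure IsArcOfLoop (γ : C(unitInterval, ℂ)) (L : Set ℂ) (β : ℂ → ℂ) (w : ℂ → ℤ) : Prop where
  injective : Function.Injective γ
  isCompact : IsCompact L
  zero_mem : γ 0 ∈ L
  one_mem : γ 1 ∈ L
  notMem : ∀ t, t ≠ 0 → t ≠ 1 → γ t ∉ L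
  sub_eq : ∀ x ∉ L, ∀ y ∉ L, ∀ h, IsLogOn L (fun z => (z - x) / (z - y)) h →
    h (γ 1) - h (γ 0) = β x - β y
  logChange_sub_eq : ∀ x ∉ L, x ∉ range γ → logChange γ x - β x = 2 * Real.pi * I * w x

namespace IsArcOfLoop

variable {γ : C(unitInterval, ℂ)} {L : Set ℂ} {β : ℂ → ℂ} {w : ℂ → ℤ}

theorem isCompact_union (H : IsArcOfLoop γ L β w) : IsCompact (L ∪ range γ) :=
  H.isCompact.union (isCompact_range γ.continuous)

theorem eq_zero_or_eq_one (H : IsArcOfLoop γ L β w) {t : unitInterval} (ht : γ t ∈ L) :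
    t = 0 ∨ t = 1 := by
  by_contra! h
  exact H.notMem t h.1 h.2 ht

theorem zero_ne_one_arc (H : IsArcOfLoop γ L β w) : γ 0 ≠ γ 1 :=
  fun h => zero_ne_one (H.injective h)

/-- `L` and `γ` meet only in the ends of `γ`. A shift by a multiple of `2πi` gives agreement at `γ
0`, and equal increments then give it at `γ 1`. -/
theorem exists_isLogOn_union (H : IsArcOfLoop γ L β w) {f k : ℂ → ℂ} (hk : IsLogOn L f k)
    {g : unitInterval → ℂ} (hg : IsLogOn univ (fun t => f (γ t)) g)
    (heq : g 1 - g 0 = k (γ 1) - k (γ 0)) : ∃ h, IsLogOn (L ∪ range γ) f h := by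
  set a := k (γ 0) - g 0
  have ha : exp a = 1 := by
    rw [exp_sub, hk.2 _ H.zero_mem, hg.2 0 (mem_univ _)]
    exact div_self (by rw [← hk.2 _ H.zero_mem]; exact exp_ne_zero _)
  obtain ⟨h, hc, h1, h2⟩ := exists_continuousOn_glue H.injective H.isCompact.isClosed
    (T := univ) isClosed_univ (g := fun t => g t + a) hk.1 (hg.1.add continuousOn_const) (by
      intro t _ ht
      rcases H.eq_zero_or_eq_one ht with rfl | rfl
      · simp [a]
      · simp only [a]
        linear_combination heq)
  rw [image_univ] at hc
  refine ⟨h, hc, ?_⟩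
  rintro z (hz | ⟨t, rfl⟩)
  · rw [h1 z hz, hk.2 z hz]
  · rw [h2 t (mem_univ t), exp_add, ha, mul_one, hg.2 t (mem_univ t)]

theorem exists_isLogOn_arc {x y : ℂ} (hx : x ∉ range γ) (hy : y ∉ range γ) :
    ∃ g, IsLogOn univ (fun t => (γ t - x) / (γ t - y)) g ∧
      g 1 - g 0 = logChange γ x - logChange γ y := by
  obtain ⟨k, hk, hkexp⟩ := exists_continuous_log_sub hx
  obtain ⟨k', hk', hkexp'⟩ := exists_continuous_log_sub hy
  refine ⟨fun t => k t - k' t, ⟨(hk.sub hk').continuousOn, fun t _ => ?_⟩, ?_⟩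
  · rw [exp_sub, hkexp, hkexp']
  · rw [logChange_eq hx hk (c := 1) (by simpa using hkexp),
      logChange_eq hy hk' (c := 1) (by simpa using hkexp')]
    ring

theorem exists_isLogOn_of_mem (H : IsArcOfLoop γ L β w) {x y : ℂ} (hx : x ∉ L)
    (hxy : y ∈ connectedComponentIn Lᶜ x) : ∃ h, IsLogOn L (fun z => (z - x) / (z - y)) h :=
  exists_isLogOn_ratio H.isCompact.isClosed isPreconnected_connectedComponentIn
    (connectedComponentIn_subset _ _) (mem_connectedComponentIn hx) hxy

/-- Identifies `w x - w y` as the obstruction to gluing a logarithm on `L` to one on `γ`. -/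
theorem logChange_sub_sub_eq (H : IsArcOfLoop γ L β w) {x y : ℂ} (hx : x ∉ L ∪ range γ)
    (hy : y ∉ L ∪ range γ) {h : ℂ → ℂ} (hh : IsLogOn L (fun z => (z - x) / (z - y)) h) :
    logChange γ x - logChange γ y =
      h (γ 1) - h (γ 0) + 2 * Real.pi * I * (w x - w y : ℤ) := by
  simp only [mem_union, not_or] at hx hy
  have h1 := H.logChange_sub_eq x hx.1 hx.2
  have h2 := H.logChange_sub_eq y hy.1 hy.2
  have h3 := H.sub_eq x hx.1 y hy.1 h hh
  push_cast
  linear_combination h1 - h2 - h3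

/-- The quotient has a logarithm on all of `L ∪ range γ`, so the obstruction vanishes. -/
theorem eq_of_connectedComponentIn_eq (H : IsArcOfLoop γ L β w) {x y : ℂ}
    (hx : x ∉ L ∪ range γ) (hy : y ∉ L ∪ range γ)
    (hxy : connectedComponentIn (L ∪ range γ)ᶜ x = connectedComponentIn (L ∪ range γ)ᶜ y) :
    w x = w y := by
  have hyx : y ∈ connectedComponentIn (L ∪ range γ)ᶜ x := hxy ▸ mem_connectedComponentIn hy
  obtain ⟨h, hh⟩ := exists_isLogOn_ratio H.isCompact_union.isClosed
    isPreconnected_connectedComponentIn (connectedComponentIn_subset _ _)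
    (mem_connectedComponentIn hx) hyx
  have h1 := H.logChange_sub_sub_eq hx hy (hh.mono subset_union_left)
  have h2 := logChange_sub_of_isLogOn (fun h => hx (Or.inr h)) (fun h => hy (Or.inr h))
    (hh.mono subset_union_right)
  have h3 : (2 * Real.pi * I) * ((w x - w y : ℤ) : ℂ) = 0 := by linear_combination h2 - h1
  have h4 := (mul_eq_zero.1 h3).resolve_left two_pi_I_ne_zero
  have h5 : w x - w y = 0 := by exact_mod_cast h4
  omega

/-- Without an obstruction the logarithms glue, and Eilenberg's criterion applies. -/
theorem connectedComponentIn_eq_of_eq (H : IsArcOfLoop γ L β w) {x y : ℂ}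
    (hx : x ∉ L ∪ range γ) (hy : y ∉ L ∪ range γ) (hxy : y ∈ connectedComponentIn Lᶜ x)
    (hw : w x = w y) :
    connectedComponentIn (L ∪ range γ)ᶜ x = connectedComponentIn (L ∪ range γ)ᶜ y := by
  obtain ⟨k, hk⟩ := H.exists_isLogOn_of_mem (fun h => hx (Or.inl h)) hxy
  obtain ⟨g, hg, hg1⟩ := exists_isLogOn_arc (fun h => hx (Or.inr h)) (fun h => hy (Or.inr h))
  obtain ⟨h, hh⟩ := H.exists_isLogOn_union hk hg (by
    rw [hg1, H.logChange_sub_sub_eq hx hy hk, hw]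
    simp)
  exact connectedComponentIn_eq_of_isLogOn H.isCompact_union hx hy hh

/-- An arc of a loop is adjacent to at most two components of the complement. -/
theorem not_three_components (H : IsArcOfLoop γ L β w) {x y z : ℂ}
    (hx : x ∉ L ∪ range γ) (hy : y ∉ L ∪ range γ) (hz : z ∉ L ∪ range γ)
    (hxy : y ∈ connectedComponentIn Lᶜ x) (hxz : z ∈ connectedComponentIn Lᶜ x)
    (hne1 : connectedComponentIn (L ∪ range γ)ᶜ x ≠ connectedComponentIn (L ∪ range γ)ᶜ y)
    (hne2 : connectedComponentIn (L ∪ range γ)ᶜ x ≠ connectedComponentIn (L ∪ range γ)ᶜ z) :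
    connectedComponentIn (L ∪ range γ)ᶜ y = connectedComponentIn (L ∪ range γ)ᶜ z := by
  by_contra hne3
  have hyz : z ∈ connectedComponentIn Lᶜ y := by rwa [← connectedComponentIn_eq hxy]
  have w1 : w x - w y ≠ 0 := fun h => hne1 (H.connectedComponentIn_eq_of_eq hx hy hxy (by omega))
  have w2 : w x - w z ≠ 0 := fun h => hne2 (H.connectedComponentIn_eq_of_eq hx hz hxz (by omega))
  have w3 : w y - w z ≠ 0 := fun h => hne3 (H.connectedComponentIn_eq_of_eq hy hz hyz (by omega))
  obtain ⟨k, hk⟩ := H.exists_isLogOn_of_mem (fun h => hx (Or.inl h)) hxy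
  obtain ⟨k', hk'⟩ := H.exists_isLogOn_of_mem (fun h => hx (Or.inl h)) hxz
  obtain ⟨g, hg, hg1⟩ := exists_isLogOn_arc (fun h => hx (Or.inr h)) (fun h => hy (Or.inr h))
  obtain ⟨g', hg', hg1'⟩ := exists_isLogOn_arc (fun h => hx (Or.inr h)) (fun h => hz (Or.inr h))
  have e1 := H.logChange_sub_sub_eq hx hy hk
  have e2 := H.logChange_sub_sub_eq hx hz hk'
  -- Each quotient is raised to the obstruction of the other, so that the two cancel.
  obtain ⟨h, hh⟩ := H.exists_isLogOn_union
    ((hk.zsmul (w x - w z)).sub (hk'.zsmul (w x - w y)))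
    ((hg.zsmul (w x - w z)).sub (hg'.zsmul (w x - w y))) (by
      linear_combination ((w x - w z : ℤ) : ℂ) * (hg1 + e1) - ((w x - w y : ℤ) : ℂ) * (hg1' + e2))
  have hh' : IsLogOn (L ∪ range γ)
      (fun u => (u - x) ^ (w y - w z) * ((u - y) ^ (w z - w x) * (u - z) ^ (w x - w y))) h := by
    refine hh.congr fun u hu => ?_
    have n1 : u - x ≠ 0 := fun h0 => hx (by rwa [← sub_eq_zero.1 h0])
    have n2 : u - y ≠ 0 := fun h0 => hy (by rwa [← sub_eq_zero.1 h0])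
    have n3 : u - z ≠ 0 := fun h0 => hz (by rwa [← sub_eq_zero.1 h0])
    have e3 : w y - w z = (w x - w z) - (w x - w y) := by ring
    have e4 : w z - w x = -(w x - w z) := by ring
    rw [e3, e4, zpow_sub₀ n1, zpow_neg, div_zpow, div_zpow]
    field_simp
  have hK := H.isCompact_union
  -- At most one of the distinct components is unbounded, and all three exponents are nonzero.
  by_cases hb : Bornology.IsBounded (connectedComponentIn (L ∪ range γ)ᶜ x)
  · exact w3 (eq_zero_of_isLogOn_zpow hK hx hy hz hb hne1 hne2 hh')
  by_cases hb' : Bornology.IsBounded (connectedComponentIn (L ∪ range γ)ᶜ y)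
  · have := eq_zero_of_isLogOn_zpow hK hy hx hz hb' (Ne.symm hne1) hne3
      (hh'.congr fun u _ => mul_left_comm _ _ _)
    omega
  · exact hne1 (connectedComponentIn_eq_of_not_isBounded hK hb hb')

/-- If an arc of a loop separates `x` from another point, it lies in the boundary of the component
of `x`. -/
theorem range_subset_frontier (H : IsArcOfLoop γ L β w) {x y : ℂ}
    (hx : x ∉ L ∪ range γ) (hy : y ∉ L ∪ range γ) (hxy : y ∈ connectedComponentIn Lᶜ x)
    (hne : connectedComponentIn (L ∪ range γ)ᶜ x ≠ connectedComponentIn (L ∪ range γ)ᶜ y) :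
    range γ ⊆ frontier (connectedComponentIn (L ∪ range γ)ᶜ x) := by
  set F := connectedComponentIn (L ∪ range γ)ᶜ x
  have hFo : IsOpen F := H.isCompact_union.isClosed.isOpen_compl.connectedComponentIn
  have hxF : x ∈ F := mem_connectedComponentIn hx
  rintro _ ⟨t₀, rfl⟩
  by_contra ht₀
  have hV : IsOpen (γ ⁻¹' (frontier F)ᶜ) := isClosed_frontier.isOpen_compl.preimage γ.continuous
  -- The offending point may be an end of `γ`; an interior point nearby is then off the frontier
  -- too, with a whole subarc.
  have hcl : t₀ ∈ closure (Ioo (0 : unitInterval) 1) := by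
    rw [closure_Ioo zero_ne_one]
    exact ⟨t₀.2.1, t₀.2.2⟩
  obtain ⟨c, hcV, hc⟩ := mem_closure_iff.1 hcl _ hV ht₀
  obtain ⟨a, b, hcab, hab⟩ := (mem_nhds_iff_exists_Ioo_subset' ⟨0, hc.1⟩ ⟨1, hc.2⟩).1
    (hV.mem_nhds hcV)
  have hT : IsClosed (Iic a ∪ Ici b) := isClosed_Iic.union isClosed_Ici
  have hK'c : IsCompact (L ∪ γ '' (Iic a ∪ Ici b)) :=
    H.isCompact.union (hT.isCompact.image γ.continuous)
  have hsub : L ∪ γ '' (Iic a ∪ Ici b) ⊆ L ∪ range γ :=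
    union_subset_union_right _ (image_subset_range _ _)
  have hfr : frontier F ⊆ L ∪ γ '' (Iic a ∪ Ici b) := by
    intro z hz
    have hzK : z ∈ L ∪ range γ := not_notMem.1 (frontier_connectedComponentIn_subset
      H.isCompact_union.isClosed.isOpen_compl x hz)
    rcases hzK with hz' | ⟨t, rfl⟩
    · exact Or.inl hz'
    · refine Or.inr ⟨t, ?_, rfl⟩
      by_contra hcon
      simp only [mem_union, mem_Iic, mem_Ici, not_or, not_le] at hcon
      exact hab hcon hz
  have hxk : x ∉ L ∪ γ '' (Iic a ∪ Ici b) := fun h => hx (hsub h)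
  have hyk : y ∉ L ∪ γ '' (Iic a ∪ Ici b) := fun h => hy (hsub h)
  obtain ⟨k, hk⟩ := H.exists_isLogOn_of_mem (fun h => hx (Or.inl h)) hxy
  obtain ⟨g, hg, -⟩ := exists_isLogOn_arc (fun h => hx (Or.inr h)) (fun h => hy (Or.inr h))
  have hlog : ∃ h, IsLogOn (L ∪ γ '' (Iic a ∪ Ici b)) (fun z => (z - x) / (z - y)) h := by
    have hone : ∀ t : unitInterval, γ t ∈ L → exp (k (γ t) - g t) = 1 := by
      intro t ht
      rw [exp_sub, hk.2 _ ht, hg.2 t (mem_univ _)]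
      exact div_self (by rw [← hk.2 _ ht]; exact exp_ne_zero _)
    have hlt : a < b := hcab.1.trans hcab.2
    classical
    -- Without the subarc, two pieces remain, each tied to `L` at one end only. Each is shifted
    -- separately, so no obstruction arises.
    set s : unitInterval → ℂ := fun t => if t ≤ a then k (γ 0) - g 0 else k (γ 1) - g 1
    have hs1 : ∀ t, exp (s t) = 1 := by
      intro t
      by_cases hta : t ≤ a
      · simp [s, hta, hone 0 H.zero_mem]
      · simp [s, hta, hone 1 H.one_mem]
    have hsc : ContinuousOn s (Iic a ∪ Ici b) := by
      refine ContinuousOn.union_of_isClosed ?_ ?_ isClosed_Iic isClosed_Ici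
      · exact (continuousOn_const (c := k (γ 0) - g 0)).congr fun t ht => by simp [s, mem_Iic.1 ht]
      · exact (continuousOn_const (c := k (γ 1) - g 1)).congr fun t ht => by
          simp [s, not_le.2 (hlt.trans_le (mem_Ici.1 ht))]
    obtain ⟨h, hcon, h1, h2⟩ := exists_continuousOn_glue H.injective H.isCompact.isClosed hT
      (g := fun t => g t + s t) hk.1 ((hg.1.mono (subset_univ _)).add hsc) (by
        intro t ht htL
        rcases H.eq_zero_or_eq_one htL with rfl | rfl
        · have : (0 : unitInterval) ≤ a := unitInterval.nonneg'
          simp [s, this]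
        · have : ¬ (1 : unitInterval) ≤ a := not_le.2 (hcab.1.trans hc.2)
          simp [s, this])
    refine ⟨h, hcon, ?_⟩
    rintro z (hz | ⟨t, ht, rfl⟩)
    · rw [h1 z hz, hk.2 z hz]
    · rw [h2 t ht, exp_add, hs1, mul_one, hg.2 t (mem_univ t)]
  obtain ⟨h, hh⟩ := hlog
  have heq := connectedComponentIn_eq_of_isLogOn hK'c hxk hyk hh
  -- The smaller set still contains `frontier F`, so the component of `x` in its complement cannot
  -- leave `F`; yet it contains `y`.
  have hFsub : connectedComponentIn (L ∪ γ '' (Iic a ∪ Ici b))ᶜ x ⊆ F := by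
    refine isPreconnected_connectedComponentIn.subset_of_closure_inter_subset hFo
      ⟨x, mem_connectedComponentIn hxk, hxF⟩ ?_
    rintro z ⟨hz, hz'⟩
    rw [closure_eq_self_union_frontier] at hz
    exact hz.resolve_right fun h0 => connectedComponentIn_subset _ _ hz' (hfr h0)
  exact hne (connectedComponentIn_eq (hFsub (heq ▸ mem_connectedComponentIn hyk)))

end IsArcOfLoop

/-! ### View angles along the perpendicular bisector -/

theorem log_div_of_re_pos {a b : ℂ} (ha : 0 < a.re) (hb : 0 < b.re) :
    log (a / b) = log a - log b := by
  have ha0 : a ≠ 0 := fun h => by simp [h] at ha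
  have hb0 : b ≠ 0 := fun h => by simp [h] at hb
  have h1 := abs_lt.1 (abs_arg_lt_pi_div_two_iff.2 (Or.inl ha))
  have h2 := abs_lt.1 (abs_arg_lt_pi_div_two_iff.2 (Or.inl hb))
  rw [← log_exp (x := log a - log b), exp_sub, exp_log ha0, exp_log hb0]
  · simp only [sub_im, log_im]
    linarith
  · simp only [sub_im, log_im]
    linarith

theorem log_neg_I_mul_of_re_pos {a : ℂ} (ha : 0 < a.re) :
    log (-I * a) = log a - Real.pi / 2 * I := by
  have ha0 : a ≠ 0 := fun h => by simp [h] at ha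
  have h1 := abs_lt.1 (abs_arg_lt_pi_div_two_iff.2 (Or.inl ha))
  have hpi := Real.pi_pos
  have him : (log a - Real.pi / 2 * I).im = arg a - Real.pi / 2 := by
    have : ((Real.pi : ℂ) / 2 * I) = ((Real.pi / 2 : ℝ) : ℂ) * I := by push_cast; ring
    rw [this]
    simp [log_im]
  rw [← log_exp (x := log a - Real.pi / 2 * I), exp_sub, exp_log ha0, exp_pi_div_two_mul_I]
  · rw [div_I]
    ring_nf
  · rw [him]
    linarith
  · rw [him]
    linarith

theorem log_I_mul_of_re_pos {a : ℂ} (ha : 0 < a.re) :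
    log (I * a) = log a + Real.pi / 2 * I := by
  have ha0 : a ≠ 0 := fun h => by simp [h] at ha
  have h1 := abs_lt.1 (abs_arg_lt_pi_div_two_iff.2 (Or.inl ha))
  have hpi := Real.pi_pos
  have him : (log a + Real.pi / 2 * I).im = arg a + Real.pi / 2 := by
    have : ((Real.pi : ℂ) / 2 * I) = ((Real.pi / 2 : ℝ) : ℂ) * I := by push_cast; ring
    rw [this]
    simp [log_im]
  rw [← log_exp (x := log a + Real.pi / 2 * I), exp_add, exp_log ha0, exp_pi_div_two_mul_I]
  · ring_nf
  · rw [him]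
    linarith
  · rw [him]
    linarith

/-- The quotient of `u - s I` by `u - t I` is not a negative real number or zero unless `u` lies
between `s I` and `t I`. -/
theorem div_mem_slitPlane {u : ℂ} {s t : ℝ} (h : ∀ r ∈ uIcc s t, u ≠ r * I) :
    (u - s * I) / (u - t * I) ∈ slitPlane := by
  have ht : u - t * I ≠ 0 := sub_ne_zero.2 (h t right_mem_uIcc)
  by_contra hr
  set r := (u - s * I) / (u - t * I) with hrdef
  simp only [mem_slitPlane_iff, not_or, not_lt, not_not] at hr
  have hre : r = (r.re : ℂ) := Complex.ext rfl (by simp [hr.2])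
  have hpos : 0 < 1 - r.re := by linarith [hr.1]
  have h1 : u - s * I = r.re * (u - t * I) := by
    rw [← hre, hrdef, div_mul_cancel₀ _ ht]
  have hposC : (1 - r.re : ℂ) ≠ 0 := by
    exact_mod_cast hpos.ne'
  -- The solution of `u - s I = ρ (u - t I)` with `ρ = r.re`; as `ρ ≤ 0`, it is a convex
  -- combination.
  refine h ((s - r.re * t) / (1 - r.re)) ?_ ?_
  · have hconv : (s - r.re * t) / (1 - r.re) =
        (1 / (1 - r.re)) • s + (-r.re / (1 - r.re)) • t := by
      simp only [smul_eq_mul]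
      field_simp
      ring
    rw [hconv]
    refine convex_uIcc s t left_mem_uIcc right_mem_uIcc (by positivity)
      (div_nonneg (by linarith [hr.1]) hpos.le) ?_
    field_simp
    ring
  · push_cast
    field_simp
    linear_combination h1

/-- Half of the (signed, imaginary) angle at which the segment from `-1/2` to `1/2` is seen from
`t I`. -/
noncomputable def viewAngle (t : ℝ) : ℂ := log (1 / 2 - t * I) - log (1 / 2 + t * I)

theorem log_div_sub_log_div (s t : ℝ) :
    log ((1 / 2 - s * I) / (1 / 2 - t * I)) - log ((-(1 / 2) - s * I) / (-(1 / 2) - t * I)) =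
      viewAngle s - viewAngle t := by
  have h : (-(1 / 2) - s * I) / (-(1 / 2) - t * I) = (1 / 2 + s * I) / (1 / 2 + t * I) := by
    rw [← neg_div_neg_eq]
    congr 1 <;> ring
  rw [h, log_div_of_re_pos (by simp) (by simp), log_div_of_re_pos (by simp) (by simp),
    viewAngle, viewAngle]
  ring

/-- Quarter turns carry the arguments to `R ± I / 2`, the form that arises in `exists_bisector_far`.
-/
theorem viewAngle_sub_viewAngle_neg {R : ℝ} (hR : 0 < R) :
    viewAngle R - viewAngle (-R) =
      2 * (log (R + 1 / 2 * I) - log (R - 1 / 2 * I)) - 2 * Real.pi * I := by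
  have h1 : (1 / 2 - R * I : ℂ) = -I * (R + 1 / 2 * I) := by
    linear_combination (1 / 2 : ℂ) * I_mul_I
  have h2 : (1 / 2 + R * I : ℂ) = I * (R - 1 / 2 * I) := by
    linear_combination (1 / 2 : ℂ) * I_mul_I
  simp only [viewAngle, ofReal_neg, neg_mul, sub_neg_eq_add, ← sub_eq_add_neg]
  rw [h1, h2, log_neg_I_mul_of_re_pos (by simpa using hR), log_I_mul_of_re_pos (by simpa using hR)]
  ring

/-- The perpendicular bisector of the ends of a path. -/
noncomputable def bisector (γ : C(unitInterval, ℂ)) (t : ℝ) : ℂ :=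
  (γ 0 + γ 1) / 2 + t * I * (γ 1 - γ 0)

/-- The coordinate in which a path runs from `-1/2` to `1/2`. -/
noncomputable def bisectorCoord (γ : C(unitInterval, ℂ)) (z : ℂ) : ℂ :=
  (z - (γ 0 + γ 1) / 2) / (γ 1 - γ 0)

theorem continuous_bisector (γ : C(unitInterval, ℂ)) : Continuous (bisector γ) := by
  unfold bisector
  fun_prop

theorem continuous_bisectorCoord (γ : C(unitInterval, ℂ)) :
    Continuous (bisectorCoord γ) := by
  unfold bisectorCoord
  fun_prop

theorem bisectorCoord_one {γ : C(unitInterval, ℂ)} (h : γ 0 ≠ γ 1) :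
    bisectorCoord γ (γ 1) = 1 / 2 := by
  have : γ 1 - γ 0 ≠ 0 := sub_ne_zero.2 h.symm
  rw [bisectorCoord]
  field_simp
  ring

theorem bisectorCoord_zero {γ : C(unitInterval, ℂ)} (h : γ 0 ≠ γ 1) :
    bisectorCoord γ (γ 0) = -(1 / 2) := by
  have : γ 1 - γ 0 ≠ 0 := sub_ne_zero.2 h.symm
  rw [bisectorCoord]
  field_simp
  ring

theorem sub_bisector {γ : C(unitInterval, ℂ)} (h : γ 0 ≠ γ 1) (z : ℂ) (t : ℝ) :
    z - bisector γ t = (γ 1 - γ 0) * (bisectorCoord γ z - t * I) := by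
  have : γ 1 - γ 0 ≠ 0 := sub_ne_zero.2 h.symm
  rw [bisector, bisectorCoord]
  field_simp
  ring

theorem sub_bisector_div {γ : C(unitInterval, ℂ)} (h : γ 0 ≠ γ 1) (z : ℂ) (s t : ℝ) :
    (z - bisector γ s) / (z - bisector γ t) =
      (bisectorCoord γ z - s * I) / (bisectorCoord γ z - t * I) := by
  have : γ 1 - γ 0 ≠ 0 := sub_ne_zero.2 h.symm
  rw [sub_bisector h, sub_bisector h, mul_div_mul_left _ _ this]

/-- The principal logarithm serves: the quotient leaves the slit plane only for `z` on the bisector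
between the two points. -/
theorem exists_isLogOn_bisector {γ : C(unitInterval, ℂ)} (h : γ 0 ≠ γ 1) {S : Set ℂ}
    {s t : ℝ} (hS : ∀ r ∈ uIcc s t, bisector γ r ∉ S) :
    ∃ k, IsLogOn S (fun z => (z - bisector γ s) / (z - bisector γ t)) k ∧
      k (γ 1) - k (γ 0) = viewAngle s - viewAngle t := by
  have hne : ∀ z ∈ S, ∀ r ∈ uIcc s t, bisectorCoord γ z ≠ r * I := by
    intro z hz r hr h0
    refine hS r hr ?_
    have h1 := sub_bisector h z r
    rw [h0, sub_self, mul_zero] at h1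
    rwa [← sub_eq_zero.1 h1]
  refine ⟨fun z => log ((bisectorCoord γ z - s * I) / (bisectorCoord γ z - t * I)), ?_, ?_⟩
  · refine (IsLogOn.log ?_ fun z hz => div_mem_slitPlane (hne z hz)).congr
      fun z _ => (sub_bisector_div h z s t).symm
    have := continuous_bisectorCoord γ
    exact ContinuousOn.div (by fun_prop) (by fun_prop)
      fun z hz => sub_ne_zero.2 (hne z hz t right_mem_uIcc)
  · simp only [bisectorCoord_one h, bisectorCoord_zero h]
    exact log_div_sub_log_div s t

theorem eventually_bisector_notMem (γ : C(unitInterval, ℂ)) {S : Set ℂ} (hS : IsClosed S)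
    {t : ℝ} (ht : bisector γ t ∉ S) : ∀ᶠ s in 𝓝 t, ∀ r ∈ uIcc s t, bisector γ r ∉ S := by
  obtain ⟨ε, hε, hball⟩ := Metric.isOpen_iff.1
    (hS.isOpen_compl.preimage (continuous_bisector γ)) t ht
  filter_upwards [Metric.ball_mem_nhds t hε] with s hs r hr
  refine hball ?_
  rw [Metric.mem_ball, Real.dist_eq] at hs ⊢
  rw [abs_sub_comm]
  exact (abs_sub_right_of_mem_uIcc hr |>.trans_eq (abs_sub_comm _ _)).trans_lt hs

/-- Far out, `γ` and its chord give the same change of the logarithm. The `2πi` arises because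
`viewAngle` is continuous at `t = 0`, where the true angle of the chord jumps by a full turn. -/
theorem exists_bisector_far {γ : C(unitInterval, ℂ)} (h : γ 0 ≠ γ 1) :
    ∃ R : ℝ, bisector γ R ∉ range γ ∧ bisector γ (-R) ∉ range γ ∧
      (logChange γ (bisector γ R) - viewAngle R) -
        (logChange γ (bisector γ (-R)) - viewAngle (-R)) = 2 * Real.pi * I := by
  have hcont := continuous_bisectorCoord γ
  obtain ⟨R₀, hR₀⟩ := ((isCompact_range γ.continuous).image hcont).isBounded.subset_closedBall 0
  set R : ℝ := max R₀ 0 + 1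
  have hR : 0 < R := by positivity
  have hnorm : ∀ t, ‖bisectorCoord γ (γ t)‖ < R := by
    intro t
    have h1 := hR₀ (mem_image_of_mem _ (mem_range_self t))
    rw [mem_closedBall_zero_iff] at h1
    exact h1.trans_lt ((le_max_left _ _).trans_lt (lt_add_one _))
  have hnot : ∀ r : ℝ, |r| = R → bisector γ r ∉ range γ := by
    rintro r hr ⟨t, ht⟩
    have h1 := sub_bisector h (γ t) r
    rw [ht, sub_self, ← ht] at h1
    have h2 := (mul_eq_zero.1 h1.symm).resolve_left (sub_ne_zero.2 h.symm)
    have h3 := hnorm t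
    rw [sub_eq_zero.1 h2] at h3
    simp [hr] at h3
  have h1 := hnot R (abs_of_pos hR)
  have h2 := hnot (-R) (by rw [abs_neg, abs_of_pos hR])
  have hre : ∀ t, |(I * bisectorCoord γ (γ t)).re| < R := by
    intro t
    refine (abs_re_le_norm _).trans_lt ?_
    simpa using hnorm t
  have hre1 : ∀ t, 0 < (R + I * bisectorCoord γ (γ t)).re := by
    intro t
    have := abs_lt.1 (hre t)
    rw [add_re, ofReal_re]
    linarith
  have hre2 : ∀ t, 0 < (R - I * bisectorCoord γ (γ t)).re := by
    intro t
    have := abs_lt.1 (hre t)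
    rw [sub_re, ofReal_re]
    linarith
  refine ⟨R, h1, h2, ?_⟩
  -- `c = -1` since `(u - R I) / (u + R I) = -(R + I u) / (R - I u)`; for `‖u‖ < R` the terms on the
  -- right have positive real part.
  have h3 := logChange_sub_logChange h1 h2 (c := -1)
    (g := fun t => log (R + I * bisectorCoord γ (γ t)) - log (R - I * bisectorCoord γ (γ t)))
    (by
      refine Continuous.sub ?_ ?_
      · exact Continuous.clog (by fun_prop) fun t => mem_slitPlane_iff.2 (Or.inl (hre1 t))
      · exact Continuous.clog (by fun_prop) fun t => mem_slitPlane_iff.2 (Or.inl (hre2 t)))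
    (by
      intro t
      have n1 : R + I * bisectorCoord γ (γ t) ≠ 0 := fun h0 => by simpa [h0] using hre1 t
      have n2 : R - I * bisectorCoord γ (γ t) ≠ 0 := fun h0 => by simpa [h0] using hre2 t
      rw [exp_sub, exp_log n1, exp_log n2, sub_bisector_div h]
      have e1 : R + I * bisectorCoord γ (γ t) = I * (bisectorCoord γ (γ t) - R * I) := by
        linear_combination (R : ℂ) * I_mul_I
      have e2 : R - I * bisectorCoord γ (γ t) = -I * (bisectorCoord γ (γ t) - (-R : ℝ) * I) := by
        push_cast
        linear_combination (R : ℂ) * I_mul_I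
      rw [e2] at n2
      have n3 := right_ne_zero_of_mul n2
      rw [e1, e2]
      field_simp [I_ne_zero])
  simp only [bisectorCoord_one h, bisectorCoord_zero h] at h3
  have h4 := viewAngle_sub_viewAngle_neg hR
  have e3 : (R : ℂ) + I * (1 / 2) = R + 1 / 2 * I := by ring
  have e4 : (R : ℂ) - I * (1 / 2) = R - 1 / 2 * I := by ring
  have e5 : (R : ℂ) + I * -(1 / 2) = R - 1 / 2 * I := by ring
  have e6 : (R : ℂ) - I * -(1 / 2) = R + 1 / 2 * I := by ring
  rw [e3, e4, e5, e6] at h3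
  linear_combination h3 - h4

/-! ### The sides of an arc of a loop: exactly two -/

namespace IsArcOfLoop

variable {γ : C(unitInterval, ℂ)} {L : Set ℂ} {β : ℂ → ℂ} {w : ℂ → ℤ}

theorem mem_connectedComponentIn_of_mem_range (H : IsArcOfLoop γ L β w) {s t : unitInterval}
    (hs : γ s ∉ L) (ht : γ t ∉ L) : γ t ∈ connectedComponentIn Lᶜ (γ s) := by
  have hpre : IsPreconnected (γ '' Ioo 0 1) :=
    isPreconnected_Ioo.image _ γ.continuous.continuousOn
  have hsub : γ '' Ioo 0 1 ⊆ Lᶜ := by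
    rintro _ ⟨r, hr, rfl⟩
    exact H.notMem r hr.1.ne' hr.2.ne
  have hmem : ∀ r, γ r ∉ L → γ r ∈ γ '' Ioo 0 1 := by
    intro r hr
    refine ⟨r, ⟨?_, ?_⟩, rfl⟩
    · exact lt_of_le_of_ne unitInterval.nonneg' fun h => hr (h ▸ H.zero_mem)
    · exact lt_of_le_of_ne unitInterval.le_one' fun h => hr (h ▸ H.one_mem)
  exact hpre.subset_connectedComponentIn (hmem s hs) hsub (hmem t ht)

/-- The differences of the winding numbers on the two sides of an arc have no common divisor. -/
theorem dvd_one (H : IsArcOfLoop γ L β w) {a : unitInterval} (ha : γ a ∉ L) {n w₀ : ℤ}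
    (hn : ∀ x ∈ connectedComponentIn Lᶜ (γ a), x ∉ L ∪ range γ → n ∣ w x - w₀) : n ∣ 1 := by
  classical
  have h01 := H.zero_ne_one_arc
  have hγc : IsClosed (range γ) := (isCompact_range γ.continuous).isClosed
  set A := AddSubgroup.zmultiples (2 * Real.pi * I * n : ℂ)
  have hA : ∀ m : ℤ, n ∣ m → (2 * Real.pi * I * m : ℂ) ∈ A := by
    rintro m ⟨j, rfl⟩
    refine AddSubgroup.mem_zmultiples_iff.2 ⟨j, ?_⟩
    simp only [zsmul_eq_mul]
    push_cast
    ring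
  -- On the arc, `β + 2πi w₀` stands in for `logChange`, which off `L ∪ range γ` exceeds it by `2πi
  -- (w - w₀)`.
  set χ : ℝ → ℂ := fun t =>
    if bisector γ t ∈ range γ then β (bisector γ t) - viewAngle t + 2 * Real.pi * I * w₀
    else logChange γ (bisector γ t) - viewAngle t
  have hχ1 : ∀ t, bisector γ t ∈ range γ →
      χ t = β (bisector γ t) - viewAngle t + 2 * Real.pi * I * w₀ := fun t ht => if_pos ht
  have hχ2 : ∀ t, bisector γ t ∉ range γ →
      χ t = logChange γ (bisector γ t) - viewAngle t := fun t ht => if_neg ht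
  have hloc : ∀ t, ∀ᶠ s in 𝓝 t, χ s - χ t ∈ A := by
    intro t
    by_cases ht : bisector γ t ∈ range γ
    · by_cases htL : bisector γ t ∈ L
      · exfalso
        obtain ⟨r, hr⟩ := ht
        rw [← hr] at htL
        have hb := sub_bisector h01 (γ r) t
        rw [← hr, sub_self] at hb
        have h2 := (mul_eq_zero.1 hb.symm).resolve_left (sub_ne_zero.2 h01.symm)
        have h3 := congrArg re (sub_eq_zero.1 h2)
        rcases H.eq_zero_or_eq_one htL with rfl | rfl
        · rw [bisectorCoord_zero h01] at h3
          norm_num at h3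
        · rw [bisectorCoord_one h01] at h3
          norm_num at h3
      · filter_upwards [eventually_bisector_notMem γ H.isCompact.isClosed htL] with s hs
        obtain ⟨k, hk, hk1⟩ := exists_isLogOn_bisector h01 hs
        have hsL : bisector γ s ∉ L := hs s left_mem_uIcc
        have e1 := H.sub_eq _ hsL _ htL k hk
        rw [hχ1 t ht]
        by_cases hsγ : bisector γ s ∈ range γ
        · rw [hχ1 s hsγ]
          convert A.zero_mem using 1
          linear_combination hk1 - e1
        · rw [hχ2 s hsγ]
          have hmem : bisector γ s ∈ connectedComponentIn Lᶜ (γ a) := by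
            obtain ⟨r, hr⟩ := ht
            have hra : bisector γ t ∈ connectedComponentIn Lᶜ (γ a) := by
              rw [← hr]
              exact H.mem_connectedComponentIn_of_mem_range ha (by rwa [hr])
            rw [connectedComponentIn_eq hra]
            have hpre : IsPreconnected (bisector γ '' uIcc s t) :=
              isPreconnected_uIcc.image _ (continuous_bisector γ).continuousOn
            refine hpre.subset_connectedComponentIn (mem_image_of_mem _ right_mem_uIcc) ?_
              (mem_image_of_mem _ left_mem_uIcc)
            rintro _ ⟨r, hr, rfl⟩
            exact hs r hr
          have e2 := H.logChange_sub_eq _ hsL hsγ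
          convert hA _ (hn _ hmem (fun h => h.elim hsL hsγ)) using 1
          push_cast
          linear_combination e2 - e1 + hk1
    · filter_upwards [eventually_bisector_notMem γ hγc ht] with s hs
      obtain ⟨k, hk, hk1⟩ := exists_isLogOn_bisector h01 hs
      have hsγ := hs s left_mem_uIcc
      rw [hχ2 t ht, hχ2 s hsγ]
      convert A.zero_mem using 1
      linear_combination logChange_sub_of_isLogOn hsγ ht hk + hk1
  obtain ⟨R, h1, h2, h3⟩ := exists_bisector_far h01
  have hall : χ R - χ (-R) ∈ A := by
    refine isPreconnected_univ.induction₂ (fun s t => χ t - χ s ∈ A) (fun t _ => ?_)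
      (fun a b c _ _ _ hab hbc => ?_) (fun a b _ _ hab => ?_) (mem_univ (-R)) (mem_univ R)
    · rw [nhdsWithin_univ]
      exact hloc t
    · convert A.add_mem hbc hab using 1
      ring
    · convert A.neg_mem hab using 1
      ring
  rw [hχ2 _ h1, hχ2 _ h2, h3] at hall
  obtain ⟨j, hj⟩ := AddSubgroup.mem_zmultiples_iff.1 hall
  refine ⟨j, ?_⟩
  have h5 : (2 * Real.pi * I) * ((n * j : ℤ) : ℂ) = (2 * Real.pi * I) * (1 : ℤ) := by
    rw [zsmul_eq_mul] at hj
    push_cast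
    linear_combination hj
  have h6 := mul_left_cancel₀ two_pi_I_ne_zero h5
  exact_mod_cast h6.symm

/-- Exactly two components of the complement have an arc of a loop in their boundary, and the
winding numbers there differ by one. -/
theorem exists_two_components (H : IsArcOfLoop γ L β w) :
    ∃ x y, x ∉ L ∪ range γ ∧ y ∉ L ∪ range γ ∧ y ∈ connectedComponentIn Lᶜ x ∧
      Odd (w x - w y) ∧ ∀ z ∉ L ∪ range γ,
        (range γ ⊆ frontier (connectedComponentIn (L ∪ range γ)ᶜ z) ↔
          connectedComponentIn (L ∪ range γ)ᶜ z = connectedComponentIn (L ∪ range γ)ᶜ x ∨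
          connectedComponentIn (L ∪ range γ)ᶜ z = connectedComponentIn (L ∪ range γ)ᶜ y) := by
  obtain ⟨a, ha0, ha1⟩ := exists_between (zero_lt_one (α := unitInterval))
  have ha : γ a ∉ L := H.notMem a ha0.ne' ha1.ne
  set M := connectedComponentIn Lᶜ (γ a) with hM
  have hex : ∀ w₀ : ℤ, ∃ x ∈ M, x ∉ L ∪ range γ ∧ w x ≠ w₀ := by
    intro w₀
    by_contra! hcon
    -- If `w` were constant on `M` off the drawing, `n = 0` would be allowed.
    have := H.dvd_one ha (n := 0) (w₀ := w₀) fun x hx hx' => by simp [hcon x hx hx']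
    simp at this
  obtain ⟨x, hxM, hx, -⟩ := hex 0
  obtain ⟨y, hyM, hy, hxy⟩ := hex (w x)
  have hMx : M = connectedComponentIn Lᶜ x := connectedComponentIn_eq hxM
  have hne : connectedComponentIn (L ∪ range γ)ᶜ x ≠ connectedComponentIn (L ∪ range γ)ᶜ y :=
    fun h => hxy (H.eq_of_connectedComponentIn_eq hx hy h).symm
  have hcases : ∀ z ∈ M, z ∉ L ∪ range γ →
      connectedComponentIn (L ∪ range γ)ᶜ z = connectedComponentIn (L ∪ range γ)ᶜ x ∨
      connectedComponentIn (L ∪ range γ)ᶜ z = connectedComponentIn (L ∪ range γ)ᶜ y := by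
    intro z hzM hz
    by_contra! hcon
    exact hcon.2 (H.not_three_components hx hy hz (hMx ▸ hyM) (hMx ▸ hzM) hne hcon.1.symm).symm
  have hMy : M = connectedComponentIn Lᶜ y := connectedComponentIn_eq hyM
  refine ⟨x, y, hx, hy, hMx ▸ hyM, ?_, fun z hz => ⟨fun hfr => ?_, ?_⟩⟩
  -- On `M`, `w` takes only the values `w x` and `w y`, so `w x - w y` divides all differences from
  -- `w y`.
  · have hdvd : w x - w y ∣ 1 := H.dvd_one ha (w₀ := w y) fun z hzM hz => by
      rcases hcases z hzM hz with h | h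
      · rw [H.eq_of_connectedComponentIn_eq hz hx h]
      · simp [H.eq_of_connectedComponentIn_eq hz hy h]
    rcases Int.isUnit_iff.1 (isUnit_of_dvd_one hdvd) with h | h <;> rw [h] <;> decide
  · refine hcases z ?_ hz
    have hMo : IsOpen M := H.isCompact.isClosed.isOpen_compl.connectedComponentIn
    obtain ⟨v, hvM, hv⟩ := mem_closure_iff.1 (frontier_subset_closure (hfr (mem_range_self a))) M
      hMo (mem_connectedComponentIn ha)
    have hsub : connectedComponentIn (L ∪ range γ)ᶜ z ⊆ connectedComponentIn Lᶜ z :=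
      connectedComponentIn_mono z (compl_subset_compl.2 subset_union_left)
    rw [hM, connectedComponentIn_eq hvM, ← connectedComponentIn_eq (hsub hv)]
    exact mem_connectedComponentIn fun h => hz (Or.inl h)
  · rintro (h | h) <;> rw [h]
    · exact H.range_subset_frontier hx hy (hMx ▸ hyM) hne
    · exact H.range_subset_frontier hy hx (hMy ▸ hxM) hne.symm

end IsArcOfLoop

/-! ### Winding numbers of closed walks -/

namespace PlaneEmbedding

variable {V : Type*} {G : SimpleGraph V} (D : PlaneEmbedding G)

/-- The edge of a dart. -/
def dartEdge (d : G.Dart) : G.edgeSet := ⟨d.edge, d.edge_mem⟩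

open Classical in
/-- The direction of the parametrization of the arc of a dart. -/
noncomputable def dartSign (d : G.Dart) : ℤ :=
  if D.arc (dartEdge d) 0 = D.point d.fst then 1 else -1

/-- The change of the logarithm of `z - x` along a dart. -/
noncomputable def dartChange (d : G.Dart) (x : ℂ) : ℂ :=
  D.dartSign d * logChange (D.arc (dartEdge d)) x

theorem dartSign_mul_self (d : G.Dart) : D.dartSign d * D.dartSign d = 1 := by
  unfold dartSign
  split_ifs <;> rfl

theorem dartSign_mul_sub (d : G.Dart) (h : ℂ → ℂ) :
    D.dartSign d * (h (D.arc (dartEdge d) 1) - h (D.arc (dartEdge d) 0)) =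
      h (D.point d.snd) - h (D.point d.fst) := by
  have h1 : s(D.arc (dartEdge d) 0, D.arc (dartEdge d) 1) = s(D.point d.fst, D.point d.snd) :=
    D.arc_ends (dartEdge d)
  have hne : D.point d.snd ≠ D.point d.fst := fun h => d.adj.ne (D.point_injective h).symm
  rcases Sym2.eq_iff.1 h1 with ⟨h0, h1⟩ | ⟨h0, h1⟩
  · simp [dartSign, h0, h1]
  · simp [dartSign, h0, h1, hne]

theorem dartChange_sub {d : G.Dart} {x y : ℂ} {S : Set ℂ} (hS : range (D.arc (dartEdge d)) ⊆ S)
    (hx : x ∉ S) (hy : y ∉ S) {h : ℂ → ℂ} (hh : IsLogOn S (fun z => (z - x) / (z - y)) h) :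
    D.dartChange d x - D.dartChange d y = h (D.point d.snd) - h (D.point d.fst) := by
  rw [← dartSign_mul_sub, dartChange, dartChange, ← mul_sub,
    logChange_sub_of_isLogOn (fun h => hx (hS h)) (fun h => hy (hS h)) (hh.mono hS)]

theorem dartChange_eq {d : G.Dart} {x c : ℂ} {S : Set ℂ} (hS : range (D.arc (dartEdge d)) ⊆ S)
    (hx : x ∉ S) {h : ℂ → ℂ} (hh : ContinuousOn h S) (hexp : ∀ z ∈ S, exp (h z) * c = z - x) :
    D.dartChange d x = h (D.point d.snd) - h (D.point d.fst) := by
  rw [← dartSign_mul_sub, dartChange, logChange_eq (c := c) (g := fun t => h (D.arc (dartEdge d) t))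
    (fun h => hx (hS h))]
  · exact hh.comp_continuous (D.arc (dartEdge d)).continuous fun t => hS (mem_range_self t)
  · exact fun t => hexp _ (hS (mem_range_self t))

theorem exp_dartChange {d : G.Dart} {x : ℂ} (hx : x ∉ range (D.arc (dartEdge d))) :
    exp (D.dartChange d x) * (D.point d.fst - x) = D.point d.snd - x := by
  obtain ⟨g, hg, hexp⟩ := exists_continuous_log_sub hx
  have h1 : s(D.arc (dartEdge d) 0, D.arc (dartEdge d) 1) = s(D.point d.fst, D.point d.snd) :=
    D.arc_ends (dartEdge d)
  have hne : D.point d.snd ≠ D.point d.fst := fun h => d.adj.ne (D.point_injective h).symm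
  rw [dartChange, logChange_eq (c := 1) hx hg (by simpa using hexp)]
  have n0 := exp_ne_zero (g 0)
  have n1 := exp_ne_zero (g 1)
  rcases Sym2.eq_iff.1 h1 with ⟨h0, h1⟩ | ⟨h0, h1⟩
  · rw [← h0, ← h1, ← hexp, ← hexp]
    simp [dartSign, h0, exp_sub]
  · rw [← h0, ← h1, ← hexp, ← hexp]
    simp [dartSign, h0, hne, exp_sub]

/-- The change of the logarithm of `z - x` along a walk. -/
noncomputable def walkChange {u v : V} (c : G.Walk u v) (x : ℂ) : ℂ :=
  (c.darts.map fun d => D.dartChange d x).sum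

theorem _root_.List.sum_map_sub_sum_map {α : Type*} (l : List α) (f g : α → ℂ) :
    (l.map f).sum - (l.map g).sum = (l.map fun a => f a - g a).sum := by
  induction l with
  | nil => simp
  | cons a l ih =>
    simp only [List.map_cons, List.sum_cons, ← ih]
    ring

theorem _root_.SimpleGraph.Walk.sum_darts_sub {u v : V} (c : G.Walk u v) (H : V → ℂ) :
    (c.darts.map fun d => H d.snd - H d.fst).sum = H v - H u := by
  induction c with
  | nil => simp
  | cons h p ih => simp [ih]

theorem exp_walkChange {u v : V} (c : G.Walk u v) {x : ℂ}
    (hx : ∀ d ∈ c.darts, x ∉ range (D.arc (dartEdge d))) :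
    exp (D.walkChange c x) * (D.point u - x) = D.point v - x := by
  induction c with
  | nil => simp [walkChange]
  | @cons u v w h p ih =>
    have h1 := D.exp_dartChange (hx ⟨(u, v), h⟩ (by simp))
    have h2 := ih fun d hd => hx d (by simp [hd])
    have h3 : D.walkChange (.cons h p) x = D.dartChange ⟨(u, v), h⟩ x + D.walkChange p x := by
      simp [walkChange]
    rw [h3, exp_add, ← h2]
    simp only at h1
    linear_combination exp (D.walkChange p x) * h1

/-- The winding number of a closed walk around `x`. -/
noncomputable def winding {u : V} (c : G.Walk u u) (x : ℂ) : ℤ :=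
  -- Off the walk the quotient is an integer already.
  round (D.walkChange c x / (2 * Real.pi * I)).re

theorem point_mem_range_arc {d : G.Dart} : D.point d.fst ∈ range (D.arc (dartEdge d)) := by
  have h1 : s(D.arc (dartEdge d) 0, D.arc (dartEdge d) 1) = s(D.point d.fst, D.point d.snd) :=
    D.arc_ends (dartEdge d)
  rcases Sym2.eq_iff.1 h1 with ⟨h0, h1⟩ | ⟨h0, h1⟩
  · exact ⟨0, h0⟩
  · exact ⟨1, h1⟩

theorem walkChange_eq_winding {u : V} (c : G.Walk u u) {x : ℂ}
    (hx : ∀ d ∈ c.darts, x ∉ range (D.arc (dartEdge d))) :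
    D.walkChange c x = 2 * Real.pi * I * D.winding c x := by
  have h1 : exp (D.walkChange c x) = 1 := by
    cases c with
    | nil => simp [walkChange]
    | @cons _ v _ h p =>
      have h1 := D.exp_walkChange _ hx
      have hne : D.point u - x ≠ 0 := fun h0 => hx ⟨(u, v), h⟩ (by simp) (by
        rw [← sub_eq_zero.1 h0]
        exact D.point_mem_range_arc (d := ⟨(u, v), h⟩))
      exact mul_right_cancel₀ hne (by rw [h1, one_mul])
  obtain ⟨n, hn⟩ := exp_eq_one_iff.1 h1
  have h2 : D.walkChange c x / (2 * Real.pi * I) = n := by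
    rw [hn]
    field_simp [two_pi_I_ne_zero]
  rw [winding, h2, hn]
  simp [mul_comm]

/-- The dart changes for `x` and `y` differ by increments of `h`, which telescope to `0` around a
closed walk. -/
theorem winding_eq_of_isLogOn {u : V} (c : G.Walk u u) {x y : ℂ} {S : Set ℂ}
    (hS : ∀ d ∈ c.darts, range (D.arc (dartEdge d)) ⊆ S) (hx : x ∉ S) (hy : y ∉ S) {h : ℂ → ℂ}
    (hh : IsLogOn S (fun z => (z - x) / (z - y)) h) : D.winding c x = D.winding c y := by
  have h1 : D.walkChange c x - D.walkChange c y = 0 := by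
    rw [walkChange, walkChange, List.sum_map_sub_sum_map, ← sub_self (h (D.point u)),
      ← c.sum_darts_sub (fun v => h (D.point v))]
    congr 1
    exact List.map_congr_left fun d hd => D.dartChange_sub (hS d hd) hx hy hh
  rw [D.walkChange_eq_winding c fun d hd h => hx (hS d hd h),
    D.walkChange_eq_winding c fun d hd h => hy (hS d hd h), ← mul_sub] at h1
  have h2 := (mul_eq_zero.1 h1).resolve_left two_pi_I_ne_zero
  have h3 : D.winding c x - D.winding c y = 0 := by exact_mod_cast h2
  omega

theorem range_arc_subset_support (e : G.edgeSet) : range (D.arc e) ⊆ D.support :=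
  (subset_iUnion (fun e => range (D.arc e)) e).trans subset_union_right

/-- On the drawing `1 - z / x` stays in the unit disc around `1`, so one logarithm serves every dart
and its increments telescope. -/
theorem winding_eq_zero {u : V} (c : G.Walk u u) {x : ℂ} (hx : ∀ z ∈ D.support, ‖z‖ < ‖x‖) :
    D.winding c x = 0 := by
  have hxs : x ∉ D.support := fun h => lt_irrefl _ (hx x h)
  have hmem : ∀ z ∈ D.support, 1 + -(z / x) ∈ slitPlane := fun z hz => by
    apply mem_slitPlane_of_norm_lt_one
    have := hx z hz
    rw [norm_neg, norm_div, div_lt_one ((norm_nonneg z).trans_lt this)]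
    exact this
  have h1 : D.walkChange c x = 0 := by
    rw [walkChange, ← sub_self (log (1 + -(D.point u / x))),
      ← c.sum_darts_sub (fun v => log (1 + -(D.point v / x)))]
    congr 1
    refine List.map_congr_left fun d hd => D.dartChange_eq (c := -x)
      (h := fun z => log (1 + -(z / x))) (D.range_arc_subset_support _) hxs
      (ContinuousOn.clog (by fun_prop) hmem) fun z hz => ?_
    have hx0 : x ≠ 0 := norm_pos_iff.1 ((norm_nonneg z).trans_lt (hx z hz))
    rw [exp_log (slitPlane_ne_zero (hmem z hz))]
    field_simp
    ring
  simp [winding, h1]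

/-! ### The two faces at an edge of a cycle -/

/-- The drawing without the relative interior of the edge `e`. -/
def supportErase (e : G.edgeSet) : Set ℂ :=
  range D.point ∪ ⋃ f : {f : G.edgeSet // f ≠ e}, range (D.arc f)

theorem supportErase_union (e : G.edgeSet) : D.supportErase e ∪ range (D.arc e) = D.support := by
  ext z
  simp only [supportErase, support, mem_union, mem_iUnion]
  constructor
  · rintro ((h | ⟨f, h⟩) | h)
    · exact Or.inl h
    · exact Or.inr ⟨f, h⟩
    · exact Or.inr ⟨e, h⟩
  · rintro (h | ⟨f, h⟩)
    · exact Or.inl (Or.inl h)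
    · by_cases hf : f = e
      · exact Or.inr (hf ▸ h)
      · exact Or.inl (Or.inr ⟨⟨f, hf⟩, h⟩)

theorem range_arc_subset_supportErase {e f : G.edgeSet} (h : f ≠ e) :
    range (D.arc f) ⊆ D.supportErase e :=
  (subset_iUnion (fun f : {f : G.edgeSet // f ≠ e} => range (D.arc f)) ⟨f, h⟩).trans
    subset_union_right

theorem isCompact_supportErase [Finite V] (e : G.edgeSet) : IsCompact (D.supportErase e) :=
  (finite_range D.point).isCompact.union
    (isCompact_iUnion fun f => isCompact_range (D.arc f).continuous)

theorem arc_end_mem_range_point (e : G.edgeSet) :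
    D.arc e 0 ∈ range D.point ∧ D.arc e 1 ∈ range D.point := by
  have h := D.arc_ends e
  have : ∀ s : Sym2 V, ∀ a b : ℂ, s(a, b) = Sym2.map D.point s →
      a ∈ range D.point ∧ b ∈ range D.point := by
    intro s a b hs
    induction s with
    | h u v =>
      rw [Sym2.map_mk] at hs
      rcases Sym2.eq_iff.1 hs with ⟨h0, h1⟩ | ⟨h0, h1⟩ <;> simp [h0, h1]
  exact this _ _ _ h

theorem arc_notMem_supportErase {e : G.edgeSet} {t : unitInterval} (h0 : t ≠ 0) (h1 : t ≠ 1) :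
    D.arc e t ∉ D.supportErase e := by
  have ht : t ∈ Ioo (0 : unitInterval) 1 :=
    ⟨lt_of_le_of_ne unitInterval.nonneg' h0.symm, lt_of_le_of_ne unitInterval.le_one' h1⟩
  have hpt : D.arc e t ∉ range D.point := by
    rintro ⟨v, hv⟩
    exact D.arc_interior_ne_point e t ht v hv.symm
  rintro (h | h)
  · exact hpt h
  · obtain ⟨⟨f, hf⟩, s, hs⟩ := mem_iUnion.1 h
    by_cases hs0 : s = 0
    · exact hpt (hs ▸ hs0 ▸ (D.arc_end_mem_range_point f).1)
    by_cases hs1 : s = 1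
    · exact hpt (hs ▸ hs1 ▸ (D.arc_end_mem_range_point f).2)
    have hs' : s ∈ Ioo (0 : unitInterval) 1 :=
      ⟨lt_of_le_of_ne unitInterval.nonneg' (Ne.symm hs0), lt_of_le_of_ne unitInterval.le_one' hs1⟩
    exact disjoint_left.1 (D.arc_interior_disjoint f e hf) ⟨s, hs', rfl⟩ ⟨t, ht, hs.symm⟩

/-- `L` is the rest of the whole drawing, so that the sides are faces of `G`. The other darts of the
cycle lead back from the end of `d` to its start, hence the minus sign in `β`; they lie in `L`
because a cycle repeats no edge. -/
theorem exists_isArcOfLoop [Finite V] {u : V} {c : G.Walk u u} (hc : c.IsCycle) {d : G.Dart}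
    (hd : d ∈ c.darts) : ∃ β, IsArcOfLoop (D.arc (dartEdge d)) (D.supportErase (dartEdge d)) β
      (fun x => D.dartSign d * D.winding c x) := by
  classical
  set l := c.darts.erase d
  have hperm : c.darts.Perm (d :: l) := List.perm_cons_erase hd
  have hnd : ((d :: l).map SimpleGraph.Dart.edge).Nodup :=
    (hperm.map _).nodup_iff.1 hc.edges_nodup
  have hl : ∀ d' ∈ l, dartEdge d' ≠ dartEdge d := by
    intro d' hd' heq
    rw [List.map_cons, List.nodup_cons] at hnd
    exact hnd.1 (List.mem_map.2 ⟨d', hd', congrArg Subtype.val heq⟩)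
  have hs : (D.dartSign d : ℂ) * D.dartSign d = 1 := by
    exact_mod_cast D.dartSign_mul_self d
  refine ⟨fun x => -D.dartSign d * (l.map fun d' => D.dartChange d' x).sum, D.arc_injective _,
    D.isCompact_supportErase _, Or.inl (D.arc_end_mem_range_point _).1,
    Or.inl (D.arc_end_mem_range_point _).2, fun t => D.arc_notMem_supportErase, ?_, ?_⟩
  · intro x hx y hy h hh
    have h1 : (l.map fun d' => D.dartChange d' x).sum - (l.map fun d' => D.dartChange d' y).sum =
        (l.map fun d' => h (D.point d'.snd) - h (D.point d'.fst)).sum := by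
      rw [List.sum_map_sub_sum_map]
      congr 1
      exact List.map_congr_left fun d' hd' =>
        D.dartChange_sub (D.range_arc_subset_supportErase (hl d' hd')) hx hy hh
    have h2 := c.sum_darts_sub (fun v => h (D.point v))
    rw [(hperm.map _).sum_eq, List.map_cons, List.sum_cons, ← h1, ← D.dartSign_mul_sub d h,
      sub_self] at h2
    linear_combination (D.dartSign d : ℂ) * h2 -
      (h (D.arc (dartEdge d) 1) - h (D.arc (dartEdge d) 0)) * hs
  · intro x hx hx'
    have h1 := D.walkChange_eq_winding c (x := x) fun d' hd' => by
      by_cases h : dartEdge d' = dartEdge d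
      · rwa [h]
      · exact fun h' => hx (D.range_arc_subset_supportErase h h')
    rw [walkChange, (hperm.map _).sum_eq, List.map_cons, List.sum_cons, dartChange] at h1
    push_cast
    linear_combination (D.dartSign d : ℂ) * h1 - logChange (D.arc (dartEdge d)) x * hs

/-- Two faces contain an edge of a cycle in their boundary, and the winding numbers of the cycle
there have different parities. -/
theorem exists_two_faces [Finite V] {u : V} {c : G.Walk u u} (hc : c.IsCycle) {e : G.edgeSet}
    (he : (e : Sym2 V) ∈ c.edges) :
    ∃ x y, x ∉ D.support ∧ y ∉ D.support ∧ y ∈ connectedComponentIn (D.supportErase e)ᶜ x ∧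
      Odd (D.winding c x - D.winding c y) ∧ ∀ F, D.IsFace F → (D.IsEdgeOfFace e F ↔
        F = connectedComponentIn D.supportᶜ x ∨ F = connectedComponentIn D.supportᶜ y) := by
  obtain ⟨d, hd, hde⟩ := List.mem_map.1 he
  obtain rfl : dartEdge d = e := Subtype.ext hde
  obtain ⟨β, H⟩ := D.exists_isArcOfLoop hc hd
  obtain ⟨x, y, hx, hy, hxy, hodd, hF⟩ := H.exists_two_components
  rw [supportErase_union] at hx hy hF
  refine ⟨x, y, hx, hy, hxy, ?_, ?_⟩
  · rw [← mul_sub] at hodd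
    exact (Int.odd_mul.1 hodd).2
  · rintro F ⟨z, hz, rfl⟩
    exact hF z hz

/-- The walk lies in the drawing without `e`, which does not separate `x` from `y`. -/
theorem winding_eq_of_mem_supportErase [Finite V] {u : V} (c : G.Walk u u) {e : G.edgeSet}
    (he : (e : Sym2 V) ∉ c.edges) {x y : ℂ} (hx : x ∉ D.support)
    (hxy : y ∈ connectedComponentIn (D.supportErase e)ᶜ x) :
    D.winding c x = D.winding c y := by
  have hx' : x ∉ D.supportErase e := fun h => hx (D.supportErase_union e ▸ Or.inl h)
  obtain ⟨h, hh⟩ := exists_isLogOn_ratio (D.isCompact_supportErase e).isClosed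
    isPreconnected_connectedComponentIn (connectedComponentIn_subset _ _)
    (mem_connectedComponentIn hx') hxy
  refine D.winding_eq_of_isLogOn c (fun d hd => D.range_arc_subset_supportErase ?_) hx'
    (connectedComponentIn_subset _ _ hxy) hh
  rintro rfl
  exact he (List.mem_map_of_mem hd)

theorem winding_eq_of_mem_face [Finite V] {u : V} (c : G.Walk u u) {x y : ℂ} (hx : x ∉ D.support)
    (hxy : y ∈ connectedComponentIn D.supportᶜ x) : D.winding c x = D.winding c y := by
  obtain ⟨h, hh⟩ := exists_isLogOn_ratio D.isCompact_support.isClosed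
    isPreconnected_connectedComponentIn (connectedComponentIn_subset _ _)
    (mem_connectedComponentIn hx) hxy
  exact D.winding_eq_of_isLogOn c (fun d _ => D.range_arc_subset_support _) hx
    (connectedComponentIn_subset _ _ hxy) hh

theorem winding_eq_zero_of_not_isBounded [Finite V] {u : V} (c : G.Walk u u) {x : ℂ}
    (hx : x ∉ D.support) (hb : ¬ Bornology.IsBounded (connectedComponentIn D.supportᶜ x)) :
    D.winding c x = 0 := by
  obtain ⟨R, hR⟩ := D.isCompact_support.isBounded.subset_closedBall (0 : ℂ)
  obtain ⟨z, hz, hzR⟩ : ∃ z ∈ connectedComponentIn D.supportᶜ x, R < ‖z‖ := by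
    by_contra! h
    exact hb ((Metric.isBounded_closedBall (x := (0 : ℂ)) (r := R)).subset fun z hz => by
      simpa using h z hz)
  rw [D.winding_eq_of_mem_face c hx hz]
  exact D.winding_eq_zero c fun w hw => (mem_closedBall_zero_iff.1 (hR hw)).trans_lt hzR

/-! ### Double counting of edges and faces -/

/-- The edges of a closed walk. -/
noncomputable def edgesOf [Finite V] {u : V} (c : G.Walk u u) : Finset G.edgeSet :=
  (toFinite {e : G.edgeSet | (e : Sym2 V) ∈ c.edges}).toFinset

theorem mem_edgesOf [Finite V] {u : V} {c : G.Walk u u} {e : G.edgeSet} :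
    e ∈ edgesOf c ↔ (e : Sym2 V) ∈ c.edges := by
  simp [edgesOf]

theorem card_edgesOf [Finite V] {u : V} {c : G.Walk u u} (hc : c.IsCycle) :
    (edgesOf c).card = c.length := by
  classical
  rw [← SimpleGraph.Walk.length_edges, ← List.toFinset_card_of_nodup hc.edges_nodup,
    ← Finset.card_map (Function.Embedding.subtype _)]
  congr 1
  ext e
  simp only [Finset.mem_map, mem_edgesOf, List.mem_toFinset]
  constructor
  · rintro ⟨f, hf, rfl⟩
    exact hf
  · exact fun he => ⟨⟨e, c.edges_subset_edgeSet he⟩, he, rfl⟩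

open Classical in
theorem clue_eq_card [Finite V] {u : V} (c : G.Walk u u) (F : Set ℂ) :
    D.clue c F = ((edgesOf c).filter fun e => D.IsEdgeOfFace e F).card := by
  rw [clue, ← ncard_coe_finset]
  congr 1
  ext e
  simp [mem_edgesOf]

open Classical in
/-- Double counting of the pairs of an edge of a closed walk and a face in a given family. -/
theorem sum_clue [Finite V] {u : V} (c : G.Walk u u) (S : Finset (Set ℂ)) :
    ∑ F ∈ S, D.clue c F = ∑ e ∈ edgesOf c, (S.filter fun F => D.IsEdgeOfFace e F).card := by
  simp only [clue_eq_card]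
  exact (Finset.sum_card_bipartiteAbove_eq_sum_card_bipartiteBelow
    (fun e F => D.IsEdgeOfFace e F)).symm

/-- The winding numbers of two closed walks in a face have different parities. -/
def OddFace {u v : V} (c₁ : G.Walk u u) (c₂ : G.Walk v v) (F : Set ℂ) : Prop :=
  ∃ z ∈ F, Odd (D.winding c₁ z + D.winding c₂ z)

theorem oddFace_iff [Finite V] {u v : V} (c₁ : G.Walk u u) (c₂ : G.Walk v v) {x : ℂ}
    (hx : x ∉ D.support) : D.OddFace c₁ c₂ (connectedComponentIn D.supportᶜ x) ↔
      Odd (D.winding c₁ x + D.winding c₂ x) := by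
  constructor
  · rintro ⟨z, hz, hodd⟩
    rwa [D.winding_eq_of_mem_face c₁ hx hz, D.winding_eq_of_mem_face c₂ hx hz]
  · exact fun h => ⟨x, mem_connectedComponentIn hx, h⟩

theorem OddFace.symm {u v : V} {c₁ : G.Walk u u} {c₂ : G.Walk v v} {F : Set ℂ}
    (h : D.OddFace c₁ c₂ F) : D.OddFace c₂ c₁ F := by
  obtain ⟨z, hz, hodd⟩ := h
  exact ⟨z, hz, by rwa [add_comm]⟩

open Classical in
-- The two faces at `e` are distinct because the winding numbers there differ by an odd number.
theorem card_filter_isEdgeOfFace [Finite V] {u : V} {c : G.Walk u u} (hc : c.IsCycle)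
    {e : G.edgeSet} (he : (e : Sym2 V) ∈ c.edges) {𝓕 : Finset (Set ℂ)}
    (h𝓕 : ∀ F ∈ 𝓕, D.IsFace F) (hall : ∀ F, D.IsFace F → D.IsEdgeOfFace e F → F ∈ 𝓕) :
    (𝓕.filter fun F => D.IsEdgeOfFace e F).card = 2 := by
  obtain ⟨x, y, hx, hy, hxy, hodd, hF⟩ := D.exists_two_faces hc he
  rw [Finset.card_eq_two]
  refine ⟨connectedComponentIn D.supportᶜ x, connectedComponentIn D.supportᶜ y, ?_, ?_⟩
  · intro h
    have hyx : y ∈ connectedComponentIn D.supportᶜ x := by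
      rw [h]
      exact mem_connectedComponentIn hy
    rw [D.winding_eq_of_mem_face c hx hyx, sub_self] at hodd
    simp at hodd
  · ext F
    simp only [Finset.mem_filter, Finset.mem_insert, Finset.mem_singleton]
    constructor
    · exact fun h => (hF F (h𝓕 F h.1)).1 h.2
    · intro h
      have hface : D.IsFace F := by
        rcases h with rfl | rfl
        · exact ⟨x, hx, rfl⟩
        · exact ⟨y, hy, rfl⟩
      have h2 := (hF F hface).2 h
      exact ⟨hall F hface h2, h2⟩

open Classical in
/-- An edge that belongs to exactly one of two cycles has exactly one side in a face where the
winding numbers have different parities. -/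
theorem card_filter_oddFace [Finite V] {u v : V} {c₁ : G.Walk u u} {c₂ : G.Walk v v}
    (h₁ : c₁.IsCycle) {e : G.edgeSet} (he₁ : (e : Sym2 V) ∈ c₁.edges)
    (he₂ : (e : Sym2 V) ∉ c₂.edges) {𝓕 : Finset (Set ℂ)}
    (h𝓕 : ∀ F ∈ 𝓕, D.IsFace F) (hall : ∀ F, D.IsFace F → D.IsEdgeOfFace e F → F ∈ 𝓕) :
    ((𝓕.filter (D.OddFace c₁ c₂)).filter fun F => D.IsEdgeOfFace e F).card = 1 := by
  obtain ⟨x, y, hx, hy, hxy, hodd, hF⟩ := D.exists_two_faces h₁ he₁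
  -- Crossing `e` does not affect `c₂`, so the parity of the sum changes.
  have hw := D.winding_eq_of_mem_supportErase c₂ he₂ hx hxy
  have hx' := D.oddFace_iff c₁ c₂ hx
  have hy' := D.oddFace_iff c₁ c₂ hy
  have hfx : D.IsFace (connectedComponentIn D.supportᶜ x) := ⟨x, hx, rfl⟩
  have hfy : D.IsFace (connectedComponentIn D.supportᶜ y) := ⟨y, hy, rfl⟩
  have hex := (hF _ hfx).2 (Or.inl rfl)
  have hey := (hF _ hfy).2 (Or.inr rfl)
  rw [Finset.card_eq_one]
  by_cases hox : D.OddFace c₁ c₂ (connectedComponentIn D.supportᶜ x)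
  · have hoy : ¬ D.OddFace c₁ c₂ (connectedComponentIn D.supportᶜ y) := by
      rw [hy']
      rw [hx'] at hox
      grind
    refine ⟨connectedComponentIn D.supportᶜ x, ?_⟩
    ext F
    simp only [Finset.mem_filter, Finset.mem_singleton]
    constructor
    · rintro ⟨⟨h1, h2⟩, h3⟩
      exact ((hF F (h𝓕 F h1)).1 h3).resolve_right fun h => hoy (h ▸ h2)
    · rintro rfl
      exact ⟨⟨hall _ hfx hex, hox⟩, hex⟩
  · have hoy : D.OddFace c₁ c₂ (connectedComponentIn D.supportᶜ y) := by
      rw [hy']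
      rw [hx'] at hox
      grind
    refine ⟨connectedComponentIn D.supportᶜ y, ?_⟩
    ext F
    simp only [Finset.mem_filter, Finset.mem_singleton]
    constructor
    · rintro ⟨⟨h1, h2⟩, h3⟩
      exact ((hF F (h𝓕 F h1)).1 h3).resolve_left fun h => hox (h ▸ h2)
    · rintro rfl
      exact ⟨⟨hall _ hfy hey, hoy⟩, hey⟩

/-- Lets the sums run over the faces at cycle edges, so finiteness of the set of all faces is not
needed. -/
theorem finite_setOf_isEdgeOfFace [Finite V] {u : V} {c : G.Walk u u} (hc : c.IsCycle) :
    {F | D.IsFace F ∧ ∃ e ∈ edgesOf c, D.IsEdgeOfFace e F}.Finite := by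
  have : {F | D.IsFace F ∧ ∃ e ∈ edgesOf c, D.IsEdgeOfFace e F} ⊆
      ⋃ e ∈ edgesOf c, {F | D.IsFace F ∧ D.IsEdgeOfFace e F} := by
    rintro F ⟨hF, e, he, heF⟩
    exact mem_biUnion (Finset.mem_coe.2 he) ⟨hF, heF⟩
  refine (Finite.biUnion (edgesOf c).finite_toSet fun e he => ?_).subset this
  obtain ⟨x, y, -, -, -, -, hF⟩ := D.exists_two_faces hc (mem_edgesOf.1 he)
  exact (toFinite {connectedComponentIn D.supportᶜ x, connectedComponentIn D.supportᶜ y}).subset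
    fun F h => (hF F h.1).1 h.2

end PlaneEmbedding

end

/-! ### Cycles with equal signatures -/

theorem mainTheorem5 {V : Type*} [Finite V] (G : SimpleGraph V) (D : PlaneEmbedding G)
    {u v : V} (c₁ : G.Walk u u) (c₂ : G.Walk v v) (h₁ : c₁.IsCycle) (h₂ : c₂.IsCycle)
    (hsig : D.signature c₁ = D.signature c₂) :
    c₁.length = c₂.length ∧ D.clue c₁ D.exteriorFace = D.clue c₂ D.exteriorFace := by
  classical
  obtain ⟨⟨hext, hextb⟩, hextu⟩ := D.existsUnique_exteriorFace.choose_spec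
  change D.IsFace D.exteriorFace at hext
  have hbdd : ∀ F, D.IsFace F → Bornology.IsBounded F → D.clue c₁ F = D.clue c₂ F :=
    fun F hF hb => congrFun hsig ⟨F, hF, hb⟩
  have hfin := ((D.finite_setOf_isEdgeOfFace h₁).union (D.finite_setOf_isEdgeOfFace h₂)).insert
    D.exteriorFace
  set 𝓕 := hfin.toFinset
  have hface : ∀ F ∈ 𝓕, D.IsFace F := by
    intro F hF
    rcases hfin.mem_toFinset.1 hF with rfl | h | h
    · exact hext
    · exact h.1
    · exact h.1
  have hall₁ : ∀ e ∈ PlaneEmbedding.edgesOf c₁, ∀ F, D.IsFace F → D.IsEdgeOfFace e F → F ∈ 𝓕 :=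
    fun e he F hF heF => hfin.mem_toFinset.2 (Or.inr (Or.inl ⟨hF, e, he, heF⟩))
  have hall₂ : ∀ e ∈ PlaneEmbedding.edgesOf c₂, ∀ F, D.IsFace F → D.IsEdgeOfFace e F → F ∈ 𝓕 :=
    fun e he F hF heF => hfin.mem_toFinset.2 (Or.inr (Or.inr ⟨hF, e, he, heF⟩))
  have hlen : c₁.length = c₂.length := by
    have hsum : ∑ F ∈ 𝓕.filter (D.OddFace c₁ c₂), D.clue c₁ F =
        ∑ F ∈ 𝓕.filter (D.OddFace c₁ c₂), D.clue c₂ F := by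
      refine Finset.sum_congr rfl fun F hF => ?_
      rw [Finset.mem_filter] at hF
      refine hbdd F (hface F hF.1) ?_
      -- The unbounded face is not odd: both winding numbers vanish there.
      by_contra hb
      obtain ⟨x, hx, rfl⟩ := hface F hF.1
      have := (D.oddFace_iff c₁ c₂ hx).1 hF.2
      rw [D.winding_eq_zero_of_not_isBounded c₁ hx hb,
        D.winding_eq_zero_of_not_isBounded c₂ hx hb] at this
      simp at this
    have hsymm : 𝓕.filter (D.OddFace c₁ c₂) = 𝓕.filter (D.OddFace c₂ c₁) :=
      Finset.filter_congr fun F _ => ⟨fun h => h.symm D, fun h => h.symm D⟩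
    -- The common edges contribute equally and cancel, whatever their number of odd sides.
    rw [D.sum_clue, D.sum_clue, ← Finset.sum_inter_add_sum_sdiff _ (PlaneEmbedding.edgesOf c₂),
      ← Finset.sum_inter_add_sum_sdiff (PlaneEmbedding.edgesOf c₂) (PlaneEmbedding.edgesOf c₁),
      Finset.inter_comm (PlaneEmbedding.edgesOf c₂), add_right_inj] at hsum
    have e1 : ∀ e ∈ PlaneEmbedding.edgesOf c₁ \ PlaneEmbedding.edgesOf c₂,
        ((𝓕.filter (D.OddFace c₁ c₂)).filter fun F => D.IsEdgeOfFace e F).card = 1 := by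
      intro e he
      rw [Finset.mem_sdiff] at he
      exact D.card_filter_oddFace h₁ (PlaneEmbedding.mem_edgesOf.1 he.1)
        (fun h => he.2 (PlaneEmbedding.mem_edgesOf.2 h)) hface (hall₁ e he.1)
    have e2 : ∀ e ∈ PlaneEmbedding.edgesOf c₂ \ PlaneEmbedding.edgesOf c₁,
        ((𝓕.filter (D.OddFace c₁ c₂)).filter fun F => D.IsEdgeOfFace e F).card = 1 := by
      intro e he
      rw [Finset.mem_sdiff] at he
      rw [hsymm]
      exact D.card_filter_oddFace h₂ (PlaneEmbedding.mem_edgesOf.1 he.1)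
        (fun h => he.2 (PlaneEmbedding.mem_edgesOf.2 h)) hface (hall₂ e he.1)
    rw [Finset.sum_congr rfl e1, Finset.sum_congr rfl e2, Finset.sum_const, Finset.sum_const] at hsum
    simp only [smul_eq_mul, mul_one] at hsum
    rw [← PlaneEmbedding.card_edgesOf h₁, ← PlaneEmbedding.card_edgesOf h₂,
      ← Finset.card_inter_add_card_sdiff _ (PlaneEmbedding.edgesOf c₂), hsum, Finset.inter_comm,
      Finset.card_inter_add_card_sdiff]
  refine ⟨hlen, ?_⟩
  -- Both totals are twice the length, as `𝓕` contains both faces at every cycle edge.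
  have hsum : ∑ F ∈ 𝓕, D.clue c₁ F = ∑ F ∈ 𝓕, D.clue c₂ F := by
    rw [D.sum_clue, D.sum_clue,
      Finset.sum_congr rfl fun e he => D.card_filter_isEdgeOfFace h₁
        (PlaneEmbedding.mem_edgesOf.1 he) hface (hall₁ e he),
      Finset.sum_congr rfl fun e he => D.card_filter_isEdgeOfFace h₂
        (PlaneEmbedding.mem_edgesOf.1 he) hface (hall₂ e he),
      Finset.sum_const, Finset.sum_const, PlaneEmbedding.card_edgesOf h₁,
      PlaneEmbedding.card_edgesOf h₂, hlen]
  have hmem : D.exteriorFace ∈ 𝓕 := hfin.mem_toFinset.2 (Or.inl rfl)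
  rw [← Finset.add_sum_erase _ _ hmem, ← Finset.add_sum_erase _ _ hmem,
    Finset.sum_congr rfl fun F hF => ?_] at hsum
  · exact Nat.add_right_cancel hsum
  · have hF' := Finset.mem_erase.1 hF
    refine hbdd F (hface F hF'.2) ?_
    by_contra hb
    exact hF'.1 (hextu F ⟨hface F hF'.2, hb⟩)
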